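/- Let $\Bbbk$ be a field and $m,n\ge 1$. **Weights and circles.** A weight is a sequence of $m$ symbols $\vee$ and $n$ symbols $\wedge$ at $m+n$ points of a line. For a weight $\lambda$, repeatedly connect neighbouring pairs $\vee\,\wedge$ by a cup, ignoring points connected in a previous step, and attach half-lines to the remaining points; gluing this cup diagram to its mirror image gives the arc diagram $e_\lambda$, in which every cup becomes a circle. A circle is written $(p,q)$ if it passes through the points $p<q$; it encloses $(p',q')$ if $p<p'<q'<q$. Exchanging the $\vee$ and $\wedge$ lying on a circle of $e_\kappa$ gives a new weight $\mu$; write then $\kappa\to\mu$. **Quivers.** The quiver $\mathrm Q$ has the weights as vertices, and for every $\kappa\to\mu$ an ascending arrow $x_\kappa^\mu$ from $\kappa$ to $\mu$ and a descending arrow $y_\kappa^\mu$ from $\mu$ to $\kappa$. Let $\overline{\mathrm Q}$ be the opposite quiver, with arrows $\bar x_\kappa^\mu$ (descending, from $\mu$ to $\kappa$) and $\bar y_\kappa^\mu$ (ascending, from $\kappa$ to $\mu$). Paths are composed from left to right. **Coefficients.** If $\lambda$ is obtained from $\kappa$ by exchanging the pair on a circle $D$ of $e_\kappa$, and $\mu$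 from $\lambda$ by exchanging the pair on a circle $C$ of $e_\lambda$, put $c_\kappa^\mu(\lambda)=1$ if $C$ is not a circle of $e_\kappa$; $c_\kappa^\mu(\lambda)=0$ if $C$ is a circle of $e_\kappa$ not enclosing $D$; and $c_\kappa^\mu(\lambda)=(-1)^{j-1}2$ if $C$ is the $j$-th circle of $e_\kappa$, from inner to outer, enclosing $D$. **Special paths.** We use the following configurations; symbols at all points that are not mentioned agree. * (a) $\kappa\to\nu\to\mu$ of the forms $\vee\wedge\wedge$, $\wedge\vee\wedge$, $\wedge\wedge\vee$ at points $p_1<p_2<p_3$, where $(p_1,p_2)$ is a circle of $e_\kappa$ and $(p_2,p_3)$ one of $e_\nu$, and with half-lines at $p_3$ in $e_\kappa$, at $p_1$ in $e_\nu$ and at $p_1,p_2$ in $e_\mu$. * (b) $\kappa\to\nu\to\mu$ of the forms $\vee\vee\wedge$, $\vee\wedge\vee$, $\wedge\vee\vee$ at points $p_1<p_2<p_3$, where $(p_2,p_3)$ is a circle of $e_\kappa$ and $(p_1,p_2)$ one of $e_\nu$, and with half-lines at $p_1$ in $e_\kappa$, at $p_3$ in $e_\nu$ and at $p_2,p_3$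 in $e_\mu$. * (c) $\kappa\to\nu\to\mu$ of the forms $\vee\vee\wedge\wedge$, $\wedge\vee\wedge\vee$, $\wedge\wedge\vee\vee$ at points $p_1<p_2<p_3<p_4$, where $(p_1,p_4)$ and $(p_2,p_3)$ are circles of $e_\kappa$, no circle of $e_\kappa$ enclosed by $(p_1,p_4)$ encloses $(p_2,p_3)$, and $(p_2,p_3)$ is a circle of $e_\nu$. * (d) $\kappa\to\nu\leftarrow\xi$, where $\kappa,\nu,\xi$ are of the forms $\vee\vee\wedge\wedge\wedge\vee$, $\wedge\vee\wedge\vee\wedge\vee$, $\wedge\vee\vee\vee\wedge\wedge$ at points $p_1<\dots<p_6$, and $(p_1,p_4),(p_2,p_3)$ are circles of $e_\kappa$, $(p_2,p_3),(p_4,p_5)$ of $e_\nu$, and $(p_3,p_6),(p_4,p_5)$ of $e_\xi$. **The ideals.** Let $\mathrm I$ be the two-sided ideal of the path algebra $\Bbbk\mathrm Q$ which presents the extended Khovanov arc algebra $\mathrm K_m^n$ as $\Bbbk\mathrm Q/\mathrm I$, i.e. the ideal generated by: the ascending and the descending length $2$ paths through $\kappa,\nu,\mu$ in cases (a) and (b);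 the differences of any two parallel paths of length $2$ with distinct endpoints; and, for every $\kappa\to\lambda$, the element $y_\kappa^\lambda x_\kappa^\lambda-\sum_{\mu:\,\lambda\to\mu}c_\kappa^\mu(\lambda)\,x_\lambda^\mu y_\lambda^\mu$. Let $\langle-,-\rangle\colon\Bbbk\mathrm Q\times\Bbbk\overline{\mathrm Q}\to\Bbbk$ be the bilinear pairing with $\langle a_1\cdots a_r,\bar b_s\cdots\bar b_1\rangle=1$ if the paths $a_1\cdots a_r$ and $b_1\cdots b_s$ are equal and $0$ otherwise, let $\mathrm I_2$ be the part of $\mathrm I$ in $\Bbbk\mathrm Q_2$ (the span of the paths of length $2$), let $\mathrm I_2^\perp=\{g\in\Bbbk\overline{\mathrm Q}_2\mid\langle \mathrm I_2,g\rangle=0\}$, and let $\overline{\mathrm I}$ be the two-sided ideal of $\Bbbk\overline{\mathrm Q}$ generated by $\mathrm I_2^\perp$, so that $\Bbbk\overline{\mathrm Q}/\overline{\mathrm I}$ is the quadratic dual of $\Bbbk\mathrm Q/\mathrm I$ (the presentation of the Koszul dual $\overline{\mathrm K}{}_m^n$ of $\mathrm K_m^n$). **Proposition.** The ideal $\overline{\mathrm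 I}$ is generated by the following quadratic relations. * *Monomial relations.* In case (c), the ascending path $\bar y_\kappa^\nu\bar y_\nu^\mu$ and the descending path $\bar x_\nu^\mu\bar x_\kappa^\nu$ are zero; in case (d), the two paths $\bar y_\kappa^\nu\bar x_\xi^\nu$ and $\bar y_\xi^\nu\bar x_\kappa^\nu$ between the two lower vertices are zero. * *Anticommutativity and Plücker-type relations.* If there is more than one path of length $2$ in $\overline{\mathrm Q}$ between two given distinct vertices (with given source and target), the sum of all these paths is $0$. * *Relations at vertices.* For every $\lambda\to\mu$, $$\bar y_\lambda^\mu\bar x_\lambda^\mu=-\sum_{\kappa:\,\kappa\to\lambda}c_\kappa^\mu(\lambda)\,\bar x_\kappa^\lambda\bar y_\kappa^\lambda .$$ -/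

import Mathlib

open scoped BigOperators
open Opposite

noncomputable section

/-! ## Path algebras of quivers -/

namespace QuiverAlg

universe u v w

/-- A path of a quiver together with its source and target. -/
abbrev PathIn (V : Type u) [Quiver.{v} V] := Σ a b : V, Quiver.Path a b

/-- The path algebra `k V` of a quiver `V`: the vector space with basis all paths
(the paths of length zero, one for each vertex, included). -/
def PathAlgebra (k : Type w) (V : Type u) [Field k] [Quiver.{v} V] := PathIn V →₀ k

namespace PathAlgebra

variable (k : Type w) {V : Type u} [Field k] [Quiver.{v} V]

instance : AddCommGroup (PathAlgebra k V) := inferInstanceAs (AddCommGroup (PathIn V →₀ k))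
instance : Module k (PathAlgebra k V) := inferInstanceAs (Module k (PathIn V →₀ k))

/-- The basis element given by a path. -/
def ofPath {a b : V} (p : Quiver.Path a b) : PathAlgebra k V :=
  Finsupp.single (⟨a, b, p⟩ : PathIn V) (1 : k)

/-- The coefficient of a path in an element of the path algebra. -/
def coeffAt {k : Type w} {V : Type u} [Field k] [Quiver.{v} V]
    (f : PathAlgebra k V) (p : PathIn V) : k :=
  (show PathIn V →₀ k from f) p

open Classical in
/-- The product of two basis elements: the concatenation `p q` (first `p`, then `q`) when the
target of `p` is the source of `q`, and zero otherwise. -/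
def mulBasis (p q : PathIn V) : PathAlgebra k V :=
  if h : q.1 = p.2.1 then ofPath k (p.2.2.comp (q.2.2.cast h rfl)) else 0

/-- The multiplication of the path algebra, extended bilinearly from the basis of paths. -/
def mulHom : PathAlgebra k V →ₗ[k] PathAlgebra k V →ₗ[k] PathAlgebra k V :=
  Finsupp.linearCombination k fun p : PathIn V =>
    (Finsupp.linearCombination k fun q : PathIn V => mulBasis k p q :
      (PathIn V →₀ k) →ₗ[k] PathAlgebra k V)

instance : Mul (PathAlgebra k V) := ⟨fun f g => mulHom k f g⟩

/-- The unit is the sum of the trivial paths at all vertices. -/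
instance [Fintype V] : One (PathAlgebra k V) :=
  ⟨∑ a : V, ofPath k (Quiver.Path.nil : Quiver.Path a a)⟩

variable {k}

theorem mul_def (f g : PathAlgebra k V) : f * g = mulHom k f g := rfl

theorem mulHom_ofPath {a b c d : V} (p : Quiver.Path a b) (q : Quiver.Path c d) :
    mulHom k (ofPath k p) (ofPath k q) = mulBasis k ⟨a, b, p⟩ ⟨c, d, q⟩ := by
  unfold mulHom
  erw [Finsupp.linearCombination_single, one_smul, Finsupp.linearCombination_single, one_smul]

theorem ofPath_mul_ofPath {a b c : V} (p : Quiver.Path a b) (q : Quiver.Path b c) :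
    ofPath k p * ofPath k q = ofPath k (p.comp q) := by
  rw [mul_def, mulHom_ofPath]
  simp [mulBasis]

theorem ofPath_mul_of_ne {a b c d : V} (p : Quiver.Path a b) (q : Quiver.Path c d) (h : c ≠ b) :
    ofPath k p * ofPath k q = 0 := by
  rw [mul_def, mulHom_ofPath]
  simp [mulBasis, h]

theorem induction_on {P : PathAlgebra k V → Prop} (f : PathAlgebra k V) (h0 : P 0)
    (hadd : ∀ f g, P f → P g → P (f + g))
    (hsmul : ∀ (r : k) (a b : V) (p : Quiver.Path a b), P (r • ofPath k p)) : P f := by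
  refine Finsupp.induction_linear (motive := P) f h0 hadd ?_
  rintro ⟨a, b, p⟩ r
  have : (Finsupp.single (⟨a, b, p⟩ : PathIn V) r : PathIn V →₀ k) = r • ofPath k p := by
    unfold ofPath
    erw [Finsupp.smul_single]
    simp
  rw [this]
  exact hsmul r a b p

theorem add_mul' (f g h : PathAlgebra k V) : (f + g) * h = f * h + g * h := by
  simp [mul_def]

theorem mul_add' (f g h : PathAlgebra k V) : f * (g + h) = f * g + f * h := by
  simp [mul_def]

theorem zero_mul' (f : PathAlgebra k V) : 0 * f = 0 := by simp [mul_def]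

theorem mul_zero' (f : PathAlgebra k V) : f * 0 = 0 := by simp [mul_def]

theorem smul_mul' (r : k) (f g : PathAlgebra k V) : (r • f) * g = r • (f * g) := by
  simp [mul_def]

theorem mul_smul' (r : k) (f g : PathAlgebra k V) : f * (r • g) = r • (f * g) := by
  simp [mul_def]

theorem mul_assoc' (f g h : PathAlgebra k V) : f * g * h = f * (g * h) := by
  induction f using induction_on with
  | h0 => simp only [zero_mul']
  | hadd f₁ f₂ h₁ h₂ => simp only [add_mul', h₁, h₂]
  | hsmul r a b p =>
    induction g using induction_on with
    | h0 => simp only [zero_mul', mul_zero']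
    | hadd f₁ f₂ h₁ h₂ => simp only [add_mul', mul_add', h₁, h₂]
    | hsmul s c d q =>
      induction h using induction_on with
      | h0 => simp only [mul_zero']
      | hadd f₁ f₂ h₁ h₂ => simp only [mul_add', h₁, h₂]
      | hsmul t e f x =>
        simp only [smul_mul', mul_smul']
        congr 3
        by_cases h₁ : c = b
        · subst h₁
          by_cases h₂ : e = d
          · subst h₂
            simp only [ofPath_mul_ofPath, Quiver.Path.comp_assoc]
          · rw [ofPath_mul_ofPath, ofPath_mul_of_ne _ _ h₂, ofPath_mul_of_ne _ _ h₂, mul_zero']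
        · rw [ofPath_mul_of_ne _ _ h₁, zero_mul']
          by_cases h₂ : e = d
          · subst h₂
            rw [ofPath_mul_ofPath, ofPath_mul_of_ne _ _ h₁]
          · rw [ofPath_mul_of_ne _ _ h₂, mul_zero']

theorem one_def [Fintype V] :
    (1 : PathAlgebra k V) = ∑ a : V, ofPath k (Quiver.Path.nil : Quiver.Path a a) := rfl

theorem one_mul' [Fintype V] (f : PathAlgebra k V) : 1 * f = f := by
  induction f using induction_on with
  | h0 => simp only [mul_zero']
  | hadd f₁ f₂ h₁ h₂ => simp only [mul_add', h₁, h₂]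
  | hsmul r a b p =>
    rw [mul_smul', mul_def, one_def, map_sum, LinearMap.sum_apply, Finset.sum_eq_single a]
    · rw [← mul_def, ofPath_mul_ofPath, Quiver.Path.nil_comp]
    · intro c _ hc
      rw [← mul_def, ofPath_mul_of_ne _ _ hc.symm]
    · intro h
      exact absurd (Finset.mem_univ a) h

theorem mul_one' [Fintype V] (f : PathAlgebra k V) : f * 1 = f := by
  induction f using induction_on with
  | h0 => simp only [zero_mul']
  | hadd f₁ f₂ h₁ h₂ => simp only [add_mul', h₁, h₂]
  | hsmul r a b p =>
    rw [smul_mul', mul_def, one_def, map_sum, Finset.sum_eq_single b]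
    · rw [← mul_def, ofPath_mul_ofPath, Quiver.Path.comp_nil]
    · intro c _ hc
      rw [← mul_def, ofPath_mul_of_ne _ _ hc]
    · intro h
      exact absurd (Finset.mem_univ b) h

instance [Fintype V] : Ring (PathAlgebra k V) :=
  { (inferInstance : AddCommGroup (PathAlgebra k V)),
    (inferInstance : Mul (PathAlgebra k V)),
    (inferInstance : One (PathAlgebra k V)) with
    left_distrib := mul_add'
    right_distrib := add_mul'
    zero_mul := zero_mul'
    mul_zero := mul_zero'
    mul_assoc := mul_assoc'
    one_mul := one_mul'
    mul_one := mul_one' }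

instance [Fintype V] : Algebra k (PathAlgebra k V) :=
  Algebra.ofModule smul_mul' mul_smul'

/-- The path `f g` of length two, as an element of the path algebra. -/
def two (k : Type w) [Field k] {a b c : V} (f : a ⟶ b) (g : b ⟶ c) : PathAlgebra k V :=
  ofPath k (f.toPath.comp g.toPath)

/-- The degree-`d` part of the path algebra: the span of the paths of length `d`. -/
def degreePart (k : Type w) (V : Type u) [Field k] [Quiver.{v} V] (d : ℕ) :
    Submodule k (PathAlgebra k V) :=
  Submodule.span k {x | ∃ (a b : V) (p : Quiver.Path a b), p.length = d ∧ x = ofPath k p}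

end PathAlgebra

/-! ## The opposite quiver, the pairing and quadratic duality -/

/-- The path `aₙ⁻ ⋯ a₂⁻ a₁⁻` in the opposite quiver attached to a path `a₁ a₂ ⋯ aₙ`. -/
def barPath {V : Type u} [Quiver.{v} V] {a : V} :
    {b : V} → Quiver.Path a b → Quiver.Path (op b) (op a)
  | _, .nil => .nil
  | _, .cons p e => (Quiver.Hom.toPath e.op).comp (barPath p)

/-- The bilinear pairing of `k Q` and `k Q⁻` with
`⟨a₁ a₂ ⋯ aₙ, bₘ⁻ ⋯ b₂⁻ b₁⁻⟩ = 1` if the paths `a₁ ⋯ aₙ` and `b₁ ⋯ bₘ` are equal, and `0` otherwise.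
-/
def pairing {k : Type w} {V : Type u} [Field k] [Quiver.{v} V]
    (f : PathAlgebra k V) (g : PathAlgebra k Vᵒᵖ) : k :=
  Finsupp.sum (f : PathIn V →₀ k) fun p r =>
    r * PathAlgebra.coeffAt g ⟨op p.2.1, op p.1, barPath p.2.2⟩

/-- `I₂^⊥`: the elements of degree two of `k Q⁻` which are orthogonal to the part `I₂`
of degree two of the ideal `I` of `k Q`. -/
def quadraticPerp {k : Type w} {V : Type u} [Field k] [Quiver.{v} V] [Fintype V]
    (I : TwoSidedIdeal (PathAlgebra k V)) : Set (PathAlgebra k Vᵒᵖ) :=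
  {g | g ∈ PathAlgebra.degreePart k Vᵒᵖ 2 ∧
    ∀ f : PathAlgebra k V, f ∈ I → f ∈ PathAlgebra.degreePart k V 2 → pairing f g = 0}

/-- The set of all (parallel) paths of length two from `a` to `b`. -/
abbrev LengthTwo {V : Type u} [Quiver.{v} V] (a b : V) := Σ c : V, (a ⟶ c) × (c ⟶ b)

end QuiverAlg

/-! ## Weights and circles -/

namespace ArcAlg

open QuiverAlg

/-- The two symbols `∨` (`down`) and `∧` (`up`). -/
inductive Arrow
  | down
  | up
  deriving DecidableEq

instance : Fintype Arrow :=
  ⟨{.down, .up}, fun x => by cases x <;> decide⟩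

/-- A weight with `m` symbols `∨` and `n` symbols `∧`. -/
@[ext]
structure Weight (m n : ℕ) where
  /-- the symbol at each of the `m + n` points, from left to right -/
  sym : Fin (m + n) → Arrow
  card_down : (Finset.univ.filter fun i => sym i = Arrow.down).card = m
  card_up : (Finset.univ.filter fun i => sym i = Arrow.up).card = n

theorem Weight.sym_injective {m n : ℕ} : Function.Injective (Weight.sym (m := m) (n := n)) :=
  fun _ _ h => Weight.ext h

instance {m n : ℕ} : Finite (Weight m n) := Finite.of_injective _ Weight.sym_injective

instance {m n : ℕ} : Fintype (Weight m n) := Fintype.ofFinite _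

variable {m n : ℕ}

/-- The cups drawn during the first `t` steps of the construction of the cup diagram of a weight:
a step connects every neighbouring pair `∨ ∧` by a cup, where points that have been connected in a
previous step are ignored. -/
def Weight.cupStep (w : Weight m n) : ℕ → Fin (m + n) → Fin (m + n) → Prop
  | 0, _, _ => False
  | t + 1, i, j =>
    w.cupStep t i j ∨
      (i < j ∧ w.sym i = Arrow.down ∧ w.sym j = Arrow.up ∧
        (∀ l, ¬ w.cupStep t i l ∧ ¬ w.cupStep t l i) ∧
        (∀ l, ¬ w.cupStep t j l ∧ ¬ w.cupStep t l j) ∧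
        ∀ x, i < x → x < j → ∃ l, w.cupStep t x l ∨ w.cupStep t l x)

/-- `w.IsCircle (i, j)`: the points `i < j` are joined by a cup of the cup diagram of `w`, that is,
`i` and `j` are the left and the right point of a (counterclockwise) circle of the arc diagram
`e_w` of degree zero, which is obtained by gluing the cup diagram of `w` to its mirror image. -/
def Weight.IsCircle (w : Weight m n) (C : Fin (m + n) × Fin (m + n)) : Prop :=
  ∃ t, w.cupStep t C.1 C.2

/-- The point `i` does not lie on a circle of `e_w`: half-lines are attached to it. -/
def Weight.IsRay (w : Weight m n) (i : Fin (m + n)) : Prop :=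
  ∀ C, w.IsCircle C → C.1 ≠ i ∧ C.2 ≠ i

/-- The circle through `C.1 < C.2` encloses the circle through `D.1 < D.2`. -/
def Encloses (C D : Fin (m + n) × Fin (m + n)) : Prop := C.1 < D.1 ∧ D.2 < C.2

/-- The set of circles `C` of `e_κ` such that `μ` is obtained from `κ` by exchanging the
`∨ ⋯ ∧` pair lying in `C`. It has at most one element; it is nonempty if and only if there is an
edge between `κ` and `μ` in the graph `Γ` for which `μ` is the endpoint of greater height. -/
def Raise (κ μ : Weight m n) :=
  {C : Fin (m + n) × Fin (m + n) // κ.IsCircle C ∧ μ.sym = κ.sym ∘ Equiv.swap C.1 C.2}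

instance (κ μ : Weight m n) : Finite (Raise κ μ) :=
  inferInstanceAs (Finite {C : Fin (m + n) × Fin (m + n) //
    κ.IsCircle C ∧ μ.sym = κ.sym ∘ Equiv.swap C.1 C.2})

/-- The quiver `Q`, the double quiver of `Γ`: for every edge of `Γ` between `κ` and `μ`, where `μ`
is obtained from `κ` by exchanging the pair `∨ ⋯ ∧` in a circle, there is an ascending arrow
`x : κ ⟶ μ` and a descending arrow `y : μ ⟶ κ`. -/
instance : Quiver (Weight m n) := ⟨fun κ μ => Raise κ μ ⊕ Raise μ κ⟩

variable {κ μ ν ξ : Weight m n}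

/-- The ascending arrow `x_κ^μ : κ ⟶ μ` of `Q`. -/
def Raise.x (C : Raise κ μ) : κ ⟶ μ := Sum.inl C

/-- The descending arrow `y_κ^μ : μ ⟶ κ` of `Q`. -/
def Raise.y (C : Raise κ μ) : μ ⟶ κ := Sum.inr C

/-- The descending arrow of the opposite quiver dual to `x_κ^μ`. -/
def Raise.xbar (C : Raise κ μ) : op μ ⟶ op κ := C.x.op

/-- The ascending arrow of the opposite quiver dual to `y_κ^μ`. -/
def Raise.ybar (C : Raise κ μ) : op κ ⟶ op μ := C.y.op

instance (κ μ : Weight m n) : Finite (κ ⟶ μ) :=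
  inferInstanceAs (Finite (Raise κ μ ⊕ Raise μ κ))

instance : Fintype (Weight m n)ᵒᵖ := Fintype.ofEquiv _ equivToOpposite

instance (a b : (Weight m n)ᵒᵖ) : Finite (a ⟶ b) :=
  Finite.of_injective (fun f : a ⟶ b => f.unop) fun _ _ h => Quiver.Hom.unop_inj h

instance (κ μ : Weight m n) : Fintype (Raise κ μ) := Fintype.ofFinite _

instance (a b : (Weight m n)ᵒᵖ) : Fintype (LengthTwo a b) := Fintype.ofFinite _

/-! ## The coefficients -/

open Classical in
/-- The integer `c_κ^μ(lam)`, where `lam` is obtained from `κ` by exchanging the pair in the circle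
`D` of `e_κ`, and `μ` is obtained from `lam` by exchanging the pair in the circle `C` of `e_lam`.
If `C` is a circle of `e_κ` enclosing `D`, then the number `j` such that `C` is the `j`-th circle
of `e_κ` enclosing `D`, from inner to outer, is the number of those circles of `e_κ` enclosing `D`
which are equal to `C` or enclosed by `C`. -/
def coeff {lam : Weight m n} (D : Raise κ lam) (C : Raise lam μ) : ℤ :=
  if ¬ κ.IsCircle C.1 then 1
  else if ¬ Encloses C.1 D.1 then 0
  else (-1) ^ ((Finset.univ.filter fun E : Fin (m + n) × Fin (m + n) =>
    κ.IsCircle E ∧ Encloses E D.1 ∧ (E = C.1 ∨ Encloses C.1 E)).card - 1) * 2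

/-! ## The special paths of length two -/

/-- Case (a): an ascending path through `κ`, `ν`, `μ` which are, at three points `p₁ < p₂ < p₃`, of
the forms `∨ ∧ ∧`, `∧ ∨ ∧`, `∧ ∧ ∨`; there is a circle through `p₁, p₂` in `e_κ` and a circle
through `p₂, p₃` in `e_ν`, and there are half-lines at `p₃` in `e_κ`, at `p₁` in `e_ν` and at
`p₁, p₂` in `e_μ`. -/
def CaseA (C : Raise κ ν) (D : Raise ν μ) : Prop :=
  ∃ p₁ p₂ p₃, C.1 = (p₁, p₂) ∧ D.1 = (p₂, p₃) ∧
    κ.IsRay p₃ ∧ ν.IsRay p₁ ∧ μ.IsRay p₁ ∧ μ.IsRay p₂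

/-- Case (b): an ascending path through `κ`, `ν`, `μ` which are, at three points `p₁ < p₂ < p₃`, of
the forms `∨ ∨ ∧`, `∨ ∧ ∨`, `∧ ∨ ∨`; there is a circle through `p₂, p₃` in `e_κ` and a circle
through `p₁, p₂` in `e_ν`, and there are half-lines at `p₁` in `e_κ`, at `p₃` in `e_ν` and at
`p₂, p₃` in `e_μ`. -/
def CaseB (C : Raise κ ν) (D : Raise ν μ) : Prop :=
  ∃ p₁ p₂ p₃, C.1 = (p₂, p₃) ∧ D.1 = (p₁, p₂) ∧
    κ.IsRay p₁ ∧ ν.IsRay p₃ ∧ μ.IsRay p₂ ∧ μ.IsRay p₃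

/-- Case (c): an ascending path through `κ`, `ν`, `μ` which are, at four points
`p₁ < p₂ < p₃ < p₄`, of the forms `∨ ∨ ∧ ∧`, `∧ ∨ ∧ ∨`, `∧ ∧ ∨ ∨`; there are nested circles through
`p₁, p₄` and through `p₂, p₃` in `e_κ` without a circle between them, and the circle through
`p₂, p₃` is also a circle of `e_ν`. -/
def CaseC (C : Raise κ ν) (D : Raise ν μ) : Prop :=
  κ.IsCircle D.1 ∧ Encloses C.1 D.1 ∧
    ¬ ∃ E, κ.IsCircle E ∧ Encloses C.1 E ∧ Encloses E D.1

/-- Case (d): two weights `κ` and `ξ` below a weight `ν` which are, at six points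
`p₁ < p₂ < p₃ < p₄ < p₅ < p₆`, of the forms `∨ ∨ ∧ ∧ ∧ ∨`, `∧ ∨ ∨ ∨ ∧ ∧` and `∧ ∨ ∧ ∨ ∧ ∨`;
there are circles through `p₁, p₄` and `p₂, p₃` in `e_κ`, circles through `p₃, p₆` and `p₄, p₅` in
`e_ξ`, and circles through `p₂, p₃` and `p₄, p₅` in `e_ν`. -/
def CaseD (C : Raise κ ν) (D : Raise ξ ν) : Prop :=
  ∃ p₁ p₂ p₃ p₄ p₅ p₆, p₁ < p₂ ∧ p₂ < p₃ ∧ p₃ < p₄ ∧ p₄ < p₅ ∧ p₅ < p₆ ∧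
    C.1 = (p₁, p₄) ∧ κ.IsCircle (p₂, p₃) ∧
    D.1 = (p₃, p₆) ∧ ξ.IsCircle (p₄, p₅) ∧
    ν.IsCircle (p₂, p₃) ∧ ν.IsCircle (p₄, p₅)

/-! ## The ideal `I` of the extended Khovanov arc algebra -/

open PathAlgebra (two)

/-- Monomial relations: the ascending and descending paths of cases (a) and (b). -/
def monomialRel (k : Type*) [Field k] (m n : ℕ) : Set (PathAlgebra k (Weight m n)) :=
  {r | ∃ (κ ν μ : Weight m n) (C : Raise κ ν) (D : Raise ν μ), (CaseA C D ∨ CaseB C D) ∧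
    (r = two k C.x D.x ∨ r = two k D.y C.y)}

/-- Commutativity relations: differences of parallel paths of length two, excluding cycles. -/
def commRel (k : Type*) [Field k] (m n : ℕ) : Set (PathAlgebra k (Weight m n)) :=
  {r | ∃ (a b : Weight m n) (p q : LengthTwo a b), a ≠ b ∧
    r = two k p.2.1 p.2.2 - two k q.2.1 q.2.2}

/-- Relations at a vertex `lam`, one for each ascending arrow `x` ending at `lam`:
`y_κ^lam x_κ^lam - ∑_μ c_κ^μ(lam) x_lam^μ y_lam^μ`, where the sum is over all ascending arrows
starting at `lam`. -/
def vertexRel (k : Type*) [Field k] (m n : ℕ) : Set (PathAlgebra k (Weight m n)) :=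
  {r | ∃ (lam κ : Weight m n) (D : Raise κ lam),
    r = two k D.y D.x - ∑ C : (Σ μ : Weight m n, Raise lam μ),
      ((coeff D C.2 : ℤ) : k) • two k C.2.x C.2.y}

/-- The ideal `I` with `K ≅ k Q / I` for the extended Khovanov arc algebra `K`. -/
def arcIdeal (k : Type*) [Field k] (m n : ℕ) : TwoSidedIdeal (PathAlgebra k (Weight m n)) :=
  TwoSidedIdeal.span (monomialRel k m n ∪ commRel k m n ∪ vertexRel k m n)

/-! ## The dual side -/

/-- The ideal of the path algebra of the opposite quiver generated by `I₂^⊥`; the quotient by it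
is the Koszul dual of `k Q / I`. -/
def dualIdeal (k : Type*) [Field k] (m n : ℕ) : TwoSidedIdeal (PathAlgebra k (Weight m n)ᵒᵖ) :=
  TwoSidedIdeal.span (quadraticPerp (arcIdeal k m n))

/-- Dual monomial relations: the ascending and descending paths of case (c), and the two paths
between the two lower vertices of case (d). -/
def dualMonomialRel (k : Type*) [Field k] (m n : ℕ) : Set (PathAlgebra k (Weight m n)ᵒᵖ) :=
  {r | ∃ (κ ν μ : Weight m n) (C : Raise κ ν) (D : Raise ν μ), CaseC C D ∧
    (r = two k C.ybar D.ybar ∨ r = two k D.xbar C.xbar)} ∪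
  {r | ∃ (κ ν ξ : Weight m n) (C : Raise κ ν) (D : Raise ξ ν), CaseD C D ∧
    (r = two k C.ybar D.xbar ∨ r = two k D.ybar C.xbar)}

/-- Anticommutativity and Plücker-type relations: for two distinct vertices with more than one
path of length two between them, the sum of all these paths. -/
def dualPluckerRel (k : Type*) [Field k] (m n : ℕ) : Set (PathAlgebra k (Weight m n)ᵒᵖ) :=
  {r | ∃ a b : (Weight m n)ᵒᵖ, a ≠ b ∧ 1 < Fintype.card (LengthTwo a b) ∧
    r = ∑ p : LengthTwo a b, two k p.2.1 p.2.2}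

/-- Dual relations at a vertex `lam`, one for each ascending arrow of the opposite quiver from
`lam` to some `μ`. The sum is over all ascending arrows of the opposite quiver ending at `lam`. -/
def dualVertexRel (k : Type*) [Field k] (m n : ℕ) : Set (PathAlgebra k (Weight m n)ᵒᵖ) :=
  {r | ∃ (lam μ : Weight m n) (C : Raise lam μ),
    r = two k C.ybar C.xbar + ∑ D : (Σ κ : Weight m n, Raise κ lam),
      ((coeff D.2 C : ℤ) : k) • two k D.2.xbar D.2.ybar}

end ArcAlg

end

/-!
The ideal `I` is generated by relations of degree two each of which is a combination of parallel
paths. Hence `I₂` is spanned by these relations (`span_le_sup_longPart`), and the orthogonal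
complement `I₂^⊥` is the direct sum of its components between pairs of vertices.

At a pair `a = b`, the relations express the cycles `y x` by the cycles `x y`; the orthogonal
complement is given by the negative transpose of the coefficient matrix, which is the matrix of the
dual relations at vertices (`pairingHom_dualVertexRel`, `sum_mem_of_eq`). The values of the
coefficients do not matter.

At a pair `a ≠ b`, the commutativity relations force the coefficients of an orthogonal element to be
equal. So the component is spanned by the sum of all paths if none of the paths is a monomial
relation, and it is zero otherwise. What remains is combinatorics: a path of one of the cases
(a), (b), (c), (d) is the only path of length two between its end points (`CaseA.middle_unique` and
its analogues), and every other path of length two with distinct end points is accompanied by a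
second one (`Weight.Adj.classification`).

The combinatorics is carried out with the height function of a weight, the walk which goes up at
every `∨` and down at every `∧`. The circles of `e_w` are the excursions of this walk
(`Weight.isCircle_iff`), and exchanging the pair on a circle lowers the walk by two along the
excursion (`Weight.Up`). Statements about circles of neighbouring weights thereby become linear
inequalities between values of one function. In this language a path from `a` to `b` writes the
difference of the two height functions as a signed sum of two intervals, which leaves few
possibilities for the middle vertex; and in the existence statements, the two exchanges commute
except when the two intervals share an end point, cross, or are immediately nested.
-/

namespace ArcAlg

variable {m n : ℕ}

/-! ### Excursions of height functions -/

/-- The points `p < q` are the first and the last step of an excursion of the height function `h`: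
the `j`-th step leads from `h j` to `h (j + 1)`, the two steps cancel, and `h` stays strictly above
its initial value in between. -/
def IsExc (h : ℕ → ℤ) (p q : ℕ) : Prop :=
  p < q ∧ h (q + 1) = h p ∧ ∀ j, p < j → j ≤ q → h p < h j

/-- Every step of `h` changes the value by at most one. -/
def UnitSteps (h : ℕ → ℤ) : Prop := ∀ j, h (j + 1) ≤ h j + 1 ∧ h j ≤ h (j + 1) + 1

/-- A step up of `h` starts an excursion if `h` returns to its value later on. -/
theorem UnitSteps.exists_right {h : ℕ → ℤ} (hs : UnitSteps h) {x z : ℕ} (hxz : x < z)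
    (hz : h z ≤ h x) (hx : h x < h (x + 1)) : ∃ y, x < y ∧ y < z ∧ IsExc h x y := by
  classical
  have hex : ∃ y, x < y ∧ h (y + 1) ≤ h x := by
    refine ⟨z - 1, ?_, ?_⟩
    · rcases Nat.lt_or_ge x (z - 1) with h1 | h1
      · exact h1
      · have : z = x + 1 := by omega
        subst this
        omega
    · rwa [Nat.sub_add_cancel (by omega)]
  obtain ⟨h1, h2⟩ := Nat.find_spec hex
  have hmin : ∀ j, x < j → j ≤ Nat.find hex → h x < h j := by
    intro j hj hjy
    rcases Nat.lt_or_ge (x + 1) j with h3 | h3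
    · have := Nat.find_min hex (m := j - 1) (by omega)
      rw [Nat.sub_add_cancel (by omega)] at this
      by_contra hcon
      exact this ⟨by omega, by omega⟩
    · have : j = x + 1 := by omega
      rwa [this]
  refine ⟨Nat.find hex, h1, ?_, h1, ?_, hmin⟩
  · by_contra hcon
    have := hmin z hxz (by omega)
    omega
  · have := hmin _ h1 le_rfl
    have := hs (Nat.find hex)
    omega

/-- A step down of `h` ends an excursion if `h` takes the value after this step before. -/
theorem UnitSteps.exists_left {h : ℕ → ℤ} (hs : UnitSteps h) {x z : ℕ} (hzx : z ≤ x)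
    (hz : h z ≤ h (x + 1)) (hx : h (x + 1) < h x) : ∃ y, z ≤ y ∧ y < x ∧ IsExc h y x := by
  induction hd : x - z using Nat.strong_induction_on generalizing z with
  | _ d ih =>
    have hne : z ≠ x := by
      rintro rfl
      omega
    by_cases hj : ∃ j, z < j ∧ j ≤ x ∧ h j ≤ h (x + 1)
    · obtain ⟨j, h1, h2, h3⟩ := hj
      obtain ⟨y, h4, h5⟩ := ih (x - j) (by omega) h2 h3 rfl
      exact ⟨y, by omega, h5⟩
    · push Not at hj
      have h1 := hj (z + 1) (by omega) (by omega)
      have h2 := hs z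
      exact ⟨z, le_rfl, by omega, by omega, by omega, fun j h3 h4 => by
        have := hj j h3 h4
        omega⟩

theorem IsExc.step_left {h : ℕ → ℤ} (hs : UnitSteps h) {p q : ℕ} (e : IsExc h p q) :
    h (p + 1) = h p + 1 := by
  have := hs p
  have := e.2.2 (p + 1) (by omega) (by have := e.1; omega)
  omega

theorem IsExc.step_right {h : ℕ → ℤ} (hs : UnitSteps h) {p q : ℕ} (e : IsExc h p q) :
    h q = h (q + 1) + 1 := by
  have := hs q
  have := e.2.2 q e.1 le_rfl
  have := e.2.1
  omega

/-! ### Circles as excursions -/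

/-- The sign of a symbol as a step of a height function: `∨` goes up and `∧` goes down. -/
def Arrow.sgn : Arrow → ℤ
  | .down => 1
  | .up => -1

/-- The height function of a weight: the number of `∨` minus the number of `∧` among the first `j`
points. It is constant beyond the last point. -/
def Weight.height (w : Weight m n) : ℕ → ℤ
  | 0 => 0
  | j + 1 => w.height j + if h : j < m + n then (w.sym ⟨j, h⟩).sgn else 0

theorem Weight.height_succ (w : Weight m n) (i : Fin (m + n)) :
    w.height (i + 1) = w.height i + (w.sym i).sgn := by
  simp [Weight.height]

theorem Weight.height_succ_of_le (w : Weight m n) {j : ℕ} (hj : m + n ≤ j) :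
    w.height (j + 1) = w.height j := by
  simp [Weight.height, hj]

theorem Weight.lt_of_height_ne (w : Weight m n) {j : ℕ} (h : w.height (j + 1) ≠ w.height j) :
    j < m + n := by
  by_contra hj
  exact h (w.height_succ_of_le (by omega))

theorem Weight.unitSteps (w : Weight m n) : UnitSteps w.height := by
  intro j
  by_cases hj : j < m + n
  · have := w.height_succ ⟨j, hj⟩
    cases hsym : w.sym ⟨j, hj⟩ <;> simp [hsym, Arrow.sgn] at this <;> omega
  · have := w.height_succ_of_le (j := j) (by omega)
    omega

theorem Weight.sym_eq_down_iff (w : Weight m n) (i : Fin (m + n)) :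
    w.sym i = Arrow.down ↔ w.height (i + 1) = w.height i + 1 := by
  rw [w.height_succ]
  cases w.sym i <;> simp [Arrow.sgn]

theorem Weight.sym_eq_up_iff (w : Weight m n) (i : Fin (m + n)) :
    w.sym i = Arrow.up ↔ w.height i = w.height (i + 1) + 1 := by
  rw [w.height_succ]
  cases w.sym i <;> simp only [Arrow.sgn, reduceCtorEq, true_iff, false_iff] <;> omega

theorem Weight.height_step (w : Weight m n) (i : Fin (m + n)) :
    w.height (i + 1) = w.height i + 1 ∨ w.height i = w.height (i + 1) + 1 := by
  rw [← w.sym_eq_down_iff, ← w.sym_eq_up_iff]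
  cases w.sym i <;> simp

theorem Weight.cupStep_mono (w : Weight m n) {s t : ℕ} (hst : s ≤ t) {i j : Fin (m + n)}
    (h : w.cupStep s i j) : w.cupStep t i j := by
  induction t, hst using Nat.le_induction with
  | base => exact h
  | succ t _ ih => exact Or.inl ih

/-- Cups drawn in the construction are excursions, and all points under a cup have been connected
when the cup is drawn. -/
theorem Weight.isExc_of_cupStep (w : Weight m n) (t : ℕ) (i j : Fin (m + n))
    (hc : w.cupStep t i j) :
    IsExc w.height i j ∧ ∀ x, i < x → x < j → ∃ l, w.cupStep t x l ∨ w.cupStep t l x := by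
  induction t generalizing i j with
  | zero => exact hc.elim
  | succ t ih =>
    rcases hc with hc | ⟨hij, hi, hj, hi', hj', hx⟩
    · refine ⟨(ih i j hc).1, fun x h1 h2 => ?_⟩
      obtain ⟨l, hl⟩ := (ih i j hc).2 x h1 h2
      exact ⟨l, hl.imp Or.inl Or.inl⟩
    · rw [w.sym_eq_down_iff] at hi
      rw [w.sym_eq_up_iff] at hj
      -- The partner of a point under the new cup lies under the new cup as well.
      have hpart : ∀ x, i < x → x < j →
          (∃ y, x < y ∧ y < j ∧ IsExc w.height x y) ∨ (∃ y, i < y ∧ y < x ∧ IsExc w.height y x) := by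
        intro x h1 h2
        obtain ⟨l, hl | hl⟩ := hx x h1 h2
        · have hxl : x < l := (ih x l hl).1.1
          refine Or.inl ⟨l, hxl, ?_, (ih x l hl).1⟩
          rcases lt_trichotomy l j with h3 | h3 | h3
          · exact h3
          · subst h3
            exact absurd hl (hj' x).2
          · obtain ⟨l', hl'⟩ := (ih x l hl).2 j h2 h3
            exact absurd hl' (by simpa using hj' l')
        · have hxl : l < x := (ih l x hl).1.1
          refine Or.inr ⟨l, ?_, hxl, (ih l x hl).1⟩
          rcases lt_trichotomy i l with h3 | h3 | h3
          · exact h3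
          · subst h3
            exact absurd hl (hi' x).1
          · obtain ⟨l', hl'⟩ := (ih l x hl).2 i h3 h1
            exact absurd hl' (by simpa using hi' l')
      have hlow : ∀ d : ℕ, (i : ℕ) + 1 + d ≤ j → w.height (i + 1) ≤ w.height (i + 1 + d) := by
        intro d
        induction d using Nat.strong_induction_on with
        | _ d ihd =>
        intro hd
        rcases Nat.eq_zero_or_pos d with h0 | h0
        · simp [h0]
        · have hN := j.2
          have key := hpart ⟨i + d, by omega⟩ (by simp [Fin.lt_def]; omega)
            (by simp [Fin.lt_def]; omega)
          rcases key with ⟨y, h1, h2, h3⟩ | ⟨y, h1, h2, h3⟩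
          · have h4 := h3.step_left w.unitSteps
            have h5 := ihd (d - 1) (by omega) (by omega)
            simp only [] at h4
            rw [show (i : ℕ) + 1 + (d - 1) = i + d by omega] at h5
            rw [show (i : ℕ) + 1 + d = i + d + 1 by omega]
            omega
          · simp only [Fin.lt_def] at h1 h2
            have h4 := h3.2.1
            have h5 := ihd (y - (i + 1)) (by omega) (by omega)
            simp only [] at h4
            rw [show (i : ℕ) + 1 + (y - (i + 1)) = y by omega] at h5
            rw [show (i : ℕ) + 1 + d = i + d + 1 by omega]
            omega
      have hhigh : ∀ d k : ℕ, k + d = j → (i : ℕ) < k → w.height j ≤ w.height k := by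
        intro d
        induction d using Nat.strong_induction_on with
        | _ d ihd =>
        intro k hk hik
        rcases Nat.eq_zero_or_pos d with h0 | h0
        · rw [← hk, h0, Nat.add_zero]
        · have hN := j.2
          have key := hpart ⟨k, by omega⟩ hik (by simp [Fin.lt_def]; omega)
          rcases key with ⟨y, h1, h2, h3⟩ | ⟨y, h1, h2, h3⟩
          · simp only [Fin.lt_def] at h1 h2
            have h4 := h3.2.1
            have h5 := ihd (j - (y + 1)) (by omega) (y + 1) (by omega) (by omega)
            simp only [] at h4
            omega
          · have h4 := h3.step_right w.unitSteps
            have h5 := ihd (d - 1) (by omega) (k + 1) (by omega) (by omega)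
            simp only [] at h4
            omega
      have hij' : (i : ℕ) < j := hij
      have e1 := hlow (j - (i + 1)) (by omega)
      rw [show (i : ℕ) + 1 + (j - (i + 1)) = j by omega] at e1
      have e2 := hhigh (j - (i + 1)) (i + 1) (by omega) (by omega)
      refine ⟨⟨hij, by omega, fun k h1 h2 => ?_⟩, fun x h1 h2 => ?_⟩
      · have := hhigh (j - k) k (by omega) h1
        omega
      · obtain ⟨l, hl⟩ := hx x h1 h2
        exact ⟨l, hl.imp Or.inl Or.inl⟩

theorem IsExc.right_unique {h : ℕ → ℤ} {p q q' : ℕ} (e : IsExc h p q) (e' : IsExc h p q') :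
    q = q' := by
  obtain ⟨h1, h2, h3⟩ := e
  obtain ⟨h1', h2', h3'⟩ := e'
  rcases lt_trichotomy q q' with hq | hq | hq
  · have := h3' (q + 1) (by omega) (by omega)
    omega
  · exact hq
  · have := h3 (q' + 1) (by omega) (by omega)
    omega

theorem IsExc.left_unique {h : ℕ → ℤ} {p p' q : ℕ} (e : IsExc h p q) (e' : IsExc h p' q) :
    p = p' := by
  obtain ⟨h1, h2, h3⟩ := e
  obtain ⟨h1', h2', h3'⟩ := e'
  rcases lt_trichotomy p p' with hq | hq | hq
  · have := h3 p' (by omega) (by omega)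
    omega
  · exact hq
  · have := h3' p (by omega) (by omega)
    omega

theorem IsExc.right_lt {w : Weight m n} {p q : ℕ} (e : IsExc w.height p q) : q < m + n := by
  refine w.lt_of_height_ne ?_
  have := e.step_right w.unitSteps
  omega

/-- Every point under an excursion is the first or the last step of an excursion under it. -/
theorem IsExc.exists_inside {w : Weight m n} {p q : ℕ} (e : IsExc w.height p q) {x : ℕ}
    (h1 : p < x) (h2 : x < q) :
    (∃ y, x < y ∧ y < q ∧ IsExc w.height x y) ∨ (∃ y, p < y ∧ y < x ∧ IsExc w.height y x) := by
  have hx := e.2.2 x h1 h2.le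
  have hx' := e.2.2 (x + 1) (by omega) (by omega)
  have hq := e.step_right w.unitSteps
  have hq' := e.2.1
  have hqN := e.right_lt
  rcases w.height_step ⟨x, by omega⟩ with hs | hs
  · exact Or.inl (w.unitSteps.exists_right h2 (by omega) (by simp only [] at hs; omega))
  · have := e.step_left w.unitSteps
    exact Or.inr (w.unitSteps.exists_left (z := p + 1) h1 (by omega) (by simp only [] at hs; omega))

/-- Every excursion is drawn as a cup: by induction on its width, all points under it have been
connected after finitely many steps. -/
theorem Weight.exists_cupStep (w : Weight m n) (i j : Fin (m + n)) (e : IsExc w.height i j) :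
    ∃ t, w.cupStep t i j := by
  induction hd : (j : ℕ) - i using Nat.strong_induction_on generalizing i j with
  | _ d ih =>
    have hcov : ∀ x : Fin (m + n), ∃ t, i < x → x < j → ∃ l, w.cupStep t x l ∨ w.cupStep t l x := by
      intro x
      by_cases hx : i < x ∧ x < j
      · obtain ⟨h1, h2⟩ := hx
        simp only [Fin.lt_def] at h1 h2
        rcases e.exists_inside h1 h2 with ⟨y, h3, h4, h5⟩ | ⟨y, h3, h4, h5⟩
        · obtain ⟨t, ht⟩ := ih (y - x) (by omega) x ⟨y, by omega⟩ h5 rfl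
          exact ⟨t, fun _ _ => ⟨_, Or.inl ht⟩⟩
        · obtain ⟨t, ht⟩ := ih (x - y) (by omega) ⟨y, by omega⟩ x h5 rfl
          exact ⟨t, fun _ _ => ⟨_, Or.inr ht⟩⟩
      · exact ⟨0, fun h1 h2 => absurd ⟨h1, h2⟩ hx⟩
    choose t ht using hcov
    let T := Finset.univ.sup t
    have hT : ∀ x, i < x → x < j → ∃ l, w.cupStep T x l ∨ w.cupStep T l x := by
      intro x h1 h2
      have hle : t x ≤ T := Finset.le_sup (Finset.mem_univ x)
      obtain ⟨l, hl⟩ := ht x h1 h2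
      exact ⟨l, hl.imp (w.cupStep_mono hle) (w.cupStep_mono hle)⟩
    have hi := e.step_left w.unitSteps
    have hj := e.step_right w.unitSteps
    -- If `i` or `j` has been connected before step `T + 1`, then they are connected to each other.
    by_cases hc : w.cupStep T i j
    · exact ⟨T, hc⟩
    · refine ⟨T + 1, Or.inr ⟨e.1, (w.sym_eq_down_iff i).2 hi, (w.sym_eq_up_iff j).2 hj, ?_, ?_, hT⟩⟩
      · refine fun l => ⟨fun hl => ?_, fun hl => ?_⟩
        · have := Fin.ext ((w.isExc_of_cupStep T _ _ hl).1.right_unique e)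
          subst this
          exact hc hl
        · have := (w.isExc_of_cupStep T _ _ hl).1.step_right w.unitSteps
          omega
      · refine fun l => ⟨fun hl => ?_, fun hl => ?_⟩
        · have := (w.isExc_of_cupStep T _ _ hl).1.step_left w.unitSteps
          omega
        · have := Fin.ext ((w.isExc_of_cupStep T _ _ hl).1.left_unique e)
          subst this
          exact hc hl

/-- The circles of `e_w` are the excursions of the height function of `w`. -/
theorem Weight.isCircle_iff (w : Weight m n) (C : Fin (m + n) × Fin (m + n)) :
    w.IsCircle C ↔ IsExc w.height C.1 C.2 :=
  ⟨fun ⟨t, ht⟩ => (w.isExc_of_cupStep t _ _ ht).1, fun e => w.exists_cupStep _ _ e⟩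

/-! ### Arrows as changes of the height function -/

theorem Weight.ext_height {v w : Weight m n} (h : ∀ j, v.height j = w.height j) : v = w := by
  ext i
  have h1 := v.height_succ i
  have h2 := w.height_succ i
  rw [h, h, h2, add_right_inj] at h1
  revert h1
  cases v.sym i <;> cases w.sym i <;> simp [Arrow.sgn]

/-- The weight obtained by exchanging the symbols at two points. -/
def Weight.swap (w : Weight m n) (i j : Fin (m + n)) : Weight m n where
  sym := w.sym ∘ Equiv.swap i j
  card_down := by
    refine Eq.trans ?_ w.card_down
    exact Finset.card_equiv (Equiv.swap i j) (by simp)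
  card_up := by
    refine Eq.trans ?_ w.card_up
    exact Finset.card_equiv (Equiv.swap i j) (by simp)

theorem height_of_sym_eq_swap {v w : Weight m n} {p q : Fin (m + n)} (hpq : p < q)
    (h : v.sym = w.sym ∘ Equiv.swap p q) (j : ℕ) :
    v.height j = w.height j +
      if (p : ℕ) < j ∧ j ≤ q then (w.sym q).sgn - (w.sym p).sgn else 0 := by
  have hpq' : (p : ℕ) < q := hpq
  induction j with
  | zero => simp [Weight.height]
  | succ j ih =>
    by_cases hj : j < m + n
    · have h1 := v.height_succ ⟨j, hj⟩
      have h2 := w.height_succ ⟨j, hj⟩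
      simp only [h, Function.comp_apply] at h1 h2
      rw [h1, h2, ih]
      by_cases h3 : (⟨j, hj⟩ : Fin (m + n)) = p
      · rw [h3, Equiv.swap_apply_left]
        have : j = p := by rw [← h3]
        rw [if_neg (by omega), if_pos (by omega)]
        ring
      · by_cases h4 : (⟨j, hj⟩ : Fin (m + n)) = q
        · rw [h4, Equiv.swap_apply_right]
          have : j = q := by rw [← h4]
          rw [if_pos (by omega), if_neg (by omega)]
          ring
        · rw [Equiv.swap_apply_of_ne_of_ne h3 h4]
          rw [Fin.ext_iff] at h3 h4
          simp only [] at h3 h4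
          have : ((p : ℕ) < j ∧ j ≤ q) ↔ ((p : ℕ) < j + 1 ∧ j + 1 ≤ q) := by omega
          simp only [this]
          ring
    · have := q.2
      rw [v.height_succ_of_le (by omega), w.height_succ_of_le (by omega), ih, if_neg (by omega),
        if_neg (by omega)]

/-- There is an edge from `κ` up to `μ`, given by the circle through `p` and `q` of `e_κ`:
exchanging the pair lowers the height function by two between `p` and `q`. -/
def Weight.Up (κ μ : Weight m n) (p q : ℕ) : Prop :=
  IsExc κ.height p q ∧ ∀ j, μ.height j = κ.height j - if p < j ∧ j ≤ q then 2 else 0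

theorem Raise.up {κ μ : Weight m n} (C : Raise κ μ) : κ.Up μ C.1.1 C.1.2 := by
  obtain ⟨⟨p, q⟩, hC, hsym⟩ := C
  have e := (κ.isCircle_iff _).1 hC
  refine ⟨e, fun j => ?_⟩
  rw [height_of_sym_eq_swap e.1 hsym, (κ.sym_eq_down_iff p).2 (e.step_left κ.unitSteps),
    (κ.sym_eq_up_iff q).2 (e.step_right κ.unitSteps)]
  split_ifs <;> simp [Arrow.sgn, sub_eq_add_neg]

theorem Weight.exists_up (κ : Weight m n) {p q : ℕ} (e : IsExc κ.height p q) :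
    ∃ (μ : Weight m n) (C : Raise κ μ), (C.1.1 : ℕ) = p ∧ (C.1.2 : ℕ) = q := by
  have hq := e.right_lt
  have hp := e.1
  exact ⟨κ.swap ⟨p, by omega⟩ ⟨q, hq⟩, ⟨⟨⟨p, by omega⟩, ⟨q, hq⟩⟩, (κ.isCircle_iff _).2 e, rfl⟩,
    rfl, rfl⟩

theorem Weight.Up.exists_raise {κ μ : Weight m n} {p q : ℕ} (h : κ.Up μ p q) :
    ∃ C : Raise κ μ, (C.1.1 : ℕ) = p ∧ (C.1.2 : ℕ) = q := by
  obtain ⟨μ', C, rfl, rfl⟩ := κ.exists_up h.1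
  have : μ = μ' := Weight.ext_height fun j => by rw [h.2, C.up.2]
  subst this
  exact ⟨C, rfl, rfl⟩

/-- The shape of a height function between two points `∧` and `∨` whose exchange creates a
circle. -/
def IsVal (h : ℕ → ℤ) (p q : ℕ) : Prop :=
  p < q ∧ h (q + 1) = h p ∧ h (p + 1) < h p ∧ h q < h p ∧ ∀ j, p < j → j ≤ q → h p ≤ h j + 1

theorem Weight.Up.isVal {κ μ : Weight m n} {p q : ℕ} (h : κ.Up μ p q) : IsVal μ.height p q := by
  have h1 := h.1.step_left κ.unitSteps
  have h2 := h.1.step_right κ.unitSteps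
  obtain ⟨⟨h3, h4, h5⟩, h6⟩ := h
  refine ⟨h3, ?_, ?_, ?_, fun j hj hj' => ?_⟩
  · rw [h6, h6, if_neg (by omega), if_neg (by omega)]
    omega
  · rw [h6, h6, if_pos (by omega), if_neg (by omega)]
    omega
  · rw [h6, h6, if_pos (by omega), if_neg (by omega)]
    omega
  · rw [h6, h6, if_neg (by omega), if_pos (by omega)]
    have := h5 j hj hj'
    omega

theorem Weight.exists_up_of_isVal (μ : Weight m n) {p q : ℕ} (h : IsVal μ.height p q) :
    ∃ κ : Weight m n, κ.Up μ p q := by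
  obtain ⟨h1, h2, h3, h4, h5⟩ := h
  have hq : q < m + n := μ.lt_of_height_ne (by omega)
  have h6 := μ.unitSteps p
  have h7 := μ.unitSteps q
  set κ := μ.swap ⟨p, by omega⟩ ⟨q, hq⟩
  have hκ : ∀ j, κ.height j = μ.height j + if p < j ∧ j ≤ q then 2 else 0 := by
    intro j
    rw [height_of_sym_eq_swap (p := ⟨p, by omega⟩) (q := ⟨q, hq⟩) h1 rfl j,
      (μ.sym_eq_up_iff ⟨p, by omega⟩).2 (by simp only []; omega),
      (μ.sym_eq_down_iff ⟨q, hq⟩).2 (by simp only []; omega)]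
    simp [Arrow.sgn]
  refine ⟨κ, ⟨h1, ?_, fun j hj hj' => ?_⟩, fun j => ?_⟩
  · rw [hκ, hκ, if_neg (by omega), if_neg (by omega), h2]
  · rw [hκ, hκ, if_neg (by omega), if_pos (by omega)]
    have := h5 j hj hj'
    omega
  · rw [hκ]
    ring

theorem Weight.Up.unique {κ μ : Weight m n} {p q p' q' : ℕ} (h : κ.Up μ p q)
    (h' : κ.Up μ p' q') : p = p' ∧ q = q' := by
  have h1 := h.1.1
  have h2 := h'.1.1
  have h3 := (h.2 (p + 1)).symm.trans (h'.2 (p + 1))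
  have h4 := (h.2 (p' + 1)).symm.trans (h'.2 (p' + 1))
  have : p = p' := by
    split_ifs at h3 h4 <;> omega
  subst this
  exact ⟨rfl, h.1.right_unique h'.1⟩

theorem Weight.Up.eq_of_left {κ μ μ' : Weight m n} {p q q' : ℕ} (h : κ.Up μ p q)
    (h' : κ.Up μ' p q') : μ = μ' := by
  obtain rfl := h.1.right_unique h'.1
  exact Weight.ext_height fun j => by rw [h.2, h'.2]

theorem Weight.Up.asymm {κ μ : Weight m n} {p q p' q' : ℕ} (h : κ.Up μ p q) :
    ¬ μ.Up κ p' q' := by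
  intro h'
  have h1 := h.1.1
  have h3 := h.2 q
  have h4 := h'.2 q
  split_ifs at h3 h4 <;> omega

instance (κ μ : Weight m n) : Subsingleton (Raise κ μ) :=
  ⟨fun C D => by
    obtain ⟨h1, h2⟩ := C.up.unique D.up
    exact Subtype.ext (Prod.ext (Fin.ext h1) (Fin.ext h2))⟩

instance (κ μ : Weight m n) : Subsingleton (κ ⟶ μ) :=
  ⟨fun f g => by
    rcases f with f | f <;> rcases g with g | g
    · rw [Subsingleton.elim f g]
    · exact (f.up.asymm g.up).elim
    · exact (f.up.asymm g.up).elim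
    · rw [Subsingleton.elim f g]⟩

/-- The weights `κ` and `μ` are joined by an edge. -/
def Weight.Adj (κ μ : Weight m n) : Prop :=
  ∃ p q, κ.Up μ p q ∨ μ.Up κ p q

theorem Weight.Adj.symm {κ μ : Weight m n} (h : κ.Adj μ) : μ.Adj κ := by
  obtain ⟨p, q, h⟩ := h
  exact ⟨p, q, h.symm⟩

theorem Weight.Up.adj {κ μ : Weight m n} {p q : ℕ} (h : κ.Up μ p q) : κ.Adj μ :=
  ⟨p, q, Or.inl h⟩

theorem Weight.adj_iff {κ μ : Weight m n} : κ.Adj μ ↔ Nonempty (κ ⟶ μ) := by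
  constructor
  · rintro ⟨p, q, h | h⟩
    · exact ⟨h.exists_raise.choose.x⟩
    · exact ⟨h.exists_raise.choose.y⟩
  · rintro ⟨C | C⟩
    · exact C.up.adj
    · exact C.up.adj.symm

/-! ### Paths of length two: existence of a second path -/

/-- Two excursions are equal, disjoint or nested. -/
theorem IsExc.trichotomy {h : ℕ → ℤ} (hs : UnitSteps h) {p q r s : ℕ} (e : IsExc h p q)
    (f : IsExc h r s) :
    (p = r ∧ q = s) ∨ q < r ∨ s < p ∨ (p < r ∧ s < q) ∨ (r < p ∧ q < s) := by
  have e1 := e.step_left hs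
  have e2 := e.step_right hs
  have f1 := f.step_left hs
  have f2 := f.step_right hs
  rcases eq_or_ne p r with rfl | hpr
  · exact Or.inl ⟨rfl, e.right_unique f⟩
  rcases eq_or_ne q s with rfl | hqs
  · exact absurd (e.left_unique f) hpr
  have e3 := e.2.2 r
  have e4 := e.2.2 s
  have f3 := f.2.2 p
  have f4 := f.2.2 q
  have e5 := e.2.2 (s + 1)
  have f5 := f.2.2 (q + 1)
  have hpq := e.1
  have hrs := f.1
  have e6 := e.2.1
  have f6 := f.2.1
  rcases eq_or_ne p s with rfl | hps
  · omega
  rcases eq_or_ne q r with rfl | hqr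
  · omega
  omega

theorem exists_last_lt {h : ℕ → ℤ} {p r : ℕ} (hpr : p < r) (hlt : h p < h r) :
    ∃ a, p ≤ a ∧ a < r ∧ h a < h r ∧ ∀ j, a < j → j ≤ r → h r ≤ h j := by
  induction hd : r - p using Nat.strong_induction_on generalizing p with
  | _ d ih =>
    by_cases hj : ∃ j, p < j ∧ j < r ∧ h j < h r
    · obtain ⟨j, h1, h2, h3⟩ := hj
      obtain ⟨a, h4, h5⟩ := ih (r - j) (by omega) h2 h3 rfl
      exact ⟨a, by omega, h5⟩
    · push Not at hj
      refine ⟨p, le_rfl, hpr, hlt, fun j h1 h2 => ?_⟩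
      rcases eq_or_ne j r with rfl | h3
      · exact le_rfl
      · exact hj j h1 (by omega)

/-- If an excursion under another one starts more than one unit above it, then there is a third
excursion in between. -/
theorem IsExc.exists_between {h : ℕ → ℤ} (hs : UnitSteps h) {p q r s : ℕ} (e : IsExc h p q)
    (f : IsExc h r s) (hpr : p < r) (hsq : s < q) (hlt : h p + 2 ≤ h r) :
    ∃ a b, IsExc h a b ∧ p < a ∧ a < r ∧ s < b ∧ b < q := by
  obtain ⟨a, ha1, ha2, ha3, ha4⟩ := exists_last_lt hpr (by omega : h p < h r)
  have h1 := hs a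
  have h2 := ha4 (a + 1) (by omega) (by omega)
  have h3 := e.step_right hs
  have h4 := e.2.1
  have hpa : p ≠ a := by
    rintro rfl
    omega
  have h5 := e.2.2 a (by omega) (by have := f.1; omega)
  obtain ⟨b, hb1, hb2, hb3⟩ := hs.exists_right (x := a) (z := q) (by have := f.1; omega)
    (by omega) (by omega)
  refine ⟨a, b, hb3, by omega, ha2, ?_, hb2⟩
  have h6 := hb3.2.1
  have h7 := ha4 (b + 1)
  have h8 := f.2.2 (b + 1)
  have h9 := f.2.1
  by_contra hcon
  rcases Nat.lt_or_ge r (b + 1) with h10 | h10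
  · rcases Nat.lt_or_ge s (b + 1) with h11 | h11
    · obtain rfl : b = s := by omega
      omega
    · have := h8 h10 h11
      omega
  · have := h7 (by omega) h10
    omega

/-- Two consecutive ascending steps at circles of `κ` may be exchanged, except if the second circle
lies immediately inside of the first one. -/
theorem Weight.Up.exchange {κ ν μ : Weight m n} {p q r s : ℕ} (h : κ.Up ν p q) (h' : ν.Up μ r s)
    (e : IsExc κ.height r s) (hne : p < r → s < q → κ.height p + 2 ≤ κ.height r) :
    ∃ ν', κ.Up ν' r s ∧ ν'.Up μ p q := by
  have hpr : p ≠ r := by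
    rintro rfl
    have := h.isVal.2.2.1
    have := h'.1.step_left ν.unitSteps
    omega
  obtain ⟨ν', C, rfl, rfl⟩ := κ.exists_up e
  refine ⟨ν', C.up, ⟨h.1.1, ?_, fun j h1 h2 => ?_⟩, fun j => ?_⟩
  · have := h.1.trichotomy κ.unitSteps e
    have := h'.1.1
    have := h.1.1
    have := h.1.2.1
    have := C.up.2 p
    have := C.up.2 (q + 1)
    have := h'.1.step_left ν.unitSteps
    have := h.2 (p + 1)
    have := h.2 p
    have := h.1.step_left κ.unitSteps
    omega
  · have := h.1.trichotomy κ.unitSteps e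
    have := h'.1.1
    have := h.1.2.2 j h1 h2
    have := C.up.2 p
    have := C.up.2 j
    have := h'.1.step_left ν.unitSteps
    have := h.2 (p + 1)
    have := h.2 p
    have := h.1.step_left κ.unitSteps
    have := e.2.2 j
    omega
  · have := h.2 j
    have := h'.2 j
    have := C.up.2 j
    omega

/-- A circle of `ν` which does not pass through any of the two exchanged points is a circle of `κ` as
well. -/
theorem Weight.Up.isExc_of_ne {κ ν : Weight m n} {p q r s : ℕ} (h : κ.Up ν p q)
    (f : IsExc ν.height r s) (hqr : q ≠ r) (hsp : s ≠ p) :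
    IsExc κ.height r s := by
  have v := h.isVal
  have f1 := f.step_left ν.unitSteps
  have f2 := f.step_right ν.unitSteps
  obtain ⟨v1, v2, v3, v4, v5⟩ := v
  obtain ⟨g1, g2, g3⟩ := f
  have key : s < p ∨ q < r ∨ (p < r ∧ s < q) ∨ (r < p ∧ q < s) := by
    have := v5 r
    have := v5 (s + 1)
    have := g3 p
    have := g3 q
    have := g3 (p + 1)
    have := g3 (q + 1)
    have := v5 s
    have := v5 (r + 1)
    rcases eq_or_ne p r with rfl | hpr
    · omega
    rcases eq_or_ne q s with rfl | hqs
    · omega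
    omega
  refine ⟨g1, ?_, fun j h1 h2 => ?_⟩
  · have := h.2 r
    have := h.2 (s + 1)
    omega
  · have := h.2 r
    have := h.2 j
    have := g3 j h1 h2
    omega

/-- For an ascending path of length two, there is a second path with the same end points, except in
three cases: the two circles share the right point of the first one and the right point of the
second one is not the right end of a circle of `κ`; the mirror image of this; the second circle lies
immediately inside of the first one. -/
theorem Weight.Adj.of_up_up {κ ν μ : Weight m n} {p q r s : ℕ} (h : κ.Up ν p q) (h' : ν.Up μ r s) :
    (q = r ∧ ∀ x, ¬ IsExc κ.height x s) ∨ (s = p ∧ ∀ x, ¬ IsExc κ.height r x) ∨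
    (IsExc κ.height r s ∧ p < r ∧ s < q ∧ κ.height r = κ.height p + 1) ∨
    ∃ ν', ν' ≠ ν ∧ κ.Adj ν' ∧ ν'.Adj μ := by
  have e1 := h.1.step_left κ.unitSteps
  have e2 := h.1.step_right κ.unitSteps
  have v1 := h.1.1
  have v2 := h.1.2.1
  have v3 := h'.1.1
  have v4 := h'.1.2.1
  rcases eq_or_ne q r with rfl | hqr
  · by_cases hx : ∃ x, IsExc κ.height x s
    · -- The second path passes through the weight obtained from `κ` at the circle on `x` and `s`,
      -- and descends to `μ` along an edge given by a circle on `x` and `p`.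
      right; right; right
      obtain ⟨x, hx⟩ := hx
      have hxp : x < p := by
        have := h.1.trichotomy κ.unitSteps hx
        have := h'.1.2.2 x
        have := h.2 x
        have := h.2 q
        have := h.2 (s + 1)
        have := hx.2.1
        have := hx.1
        omega
      obtain ⟨ν', C, hC1, hC2⟩ := κ.exists_up hx
      have c := C.up
      rw [hC1, hC2] at c
      refine ⟨ν', ?_, c.adj, Weight.Adj.symm ⟨x, p, Or.inl ⟨⟨hxp, ?_, fun j h1 h2 => ?_⟩,
        fun j => ?_⟩⟩⟩
      · rintro rfl
        have := (c.unique h).1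
        omega
      · have := h'.2 (p + 1)
        have := h'.2 x
        have := h.2 (p + 1)
        have := h.2 x
        have := h.2 q
        have := h.2 (s + 1)
        have := hx.2.1
        omega
      · have := h'.2 j
        have := h'.2 x
        have := h.2 j
        have := h.2 x
        have := hx.2.2 j
        omega
      · have := h'.2 j
        have := h.2 j
        have := c.2 j
        omega
    · left
      exact ⟨rfl, by simpa using hx⟩
  rcases eq_or_ne s p with rfl | hsp
  · by_cases hx : ∃ x, IsExc κ.height r x
    · right; right; right
      obtain ⟨x, hx⟩ := hx
      have hqx : q < x := by
        have := h.1.trichotomy κ.unitSteps hx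
        have := h'.1.2.2 (x + 1)
        have := h.2 (x + 1)
        have := h.2 r
        have := hx.2.1
        have := hx.1
        omega
      obtain ⟨ν', C, hC1, hC2⟩ := κ.exists_up hx
      have c := C.up
      rw [hC1, hC2] at c
      have h3 := h.2 r
      have h4 := h.2 s
      have h5 := h.2 (s + 1)
      refine ⟨ν', ?_, c.adj, Weight.Adj.symm ⟨q, x, Or.inl ⟨⟨hqx, ?_, fun j h1 h2 => ?_⟩,
        fun j => ?_⟩⟩⟩
      · rintro rfl
        have := (c.unique h).1
        omega
      · have := h'.2 (x + 1)
        have := h'.2 q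
        have := h.2 (x + 1)
        have := h.2 q
        have := hx.2.1
        omega
      · have := h'.2 j
        have := h'.2 q
        have := h.2 j
        have := h.2 q
        have := hx.2.2 j
        omega
      · have := h'.2 j
        have := h.2 j
        have := c.2 j
        omega
    · right; left
      exact ⟨rfl, by simpa using hx⟩
  have e := h.isExc_of_ne h'.1 hqr hsp
  by_cases hC : p < r ∧ s < q ∧ κ.height r = κ.height p + 1
  · exact Or.inr (Or.inr (Or.inl ⟨e, hC⟩))
  · right; right; right
    obtain ⟨ν', h1, h2⟩ := h.exchange h' e (fun h1 h2 => by
      have := h.1.2.2 r h1 (by omega)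
      omega)
    refine ⟨ν', ?_, h1.adj, h2.adj⟩
    rintro rfl
    obtain ⟨rfl, rfl⟩ := h1.unique h
    have := h1.isVal.2.2.1
    have := h'.1.step_left ν'.unitSteps
    omega

/-- For two distinct ascending arrows out of the same weight, there is always a second path between
their targets. -/
theorem Weight.Adj.of_down_up {lam κ μ : Weight m n} {p q r s : ℕ} (h : lam.Up κ p q)
    (h' : lam.Up μ r s) (hne : κ ≠ μ) : ∃ ν, ν ≠ lam ∧ κ.Adj ν ∧ ν.Adj μ := by
  -- By symmetry, the circle on `p` and `q` may be taken to start first.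
  wlog hpr : p ≤ r generalizing κ μ p q r s
  · obtain ⟨ν, h1, h2, h3⟩ := this h' h hne.symm (by omega)
    exact ⟨ν, h1, h3.symm, h2.symm⟩
  have h1 := h.1.step_left lam.unitSteps
  have h2 := h.1.2.1
  have h3 := h'.1.step_left lam.unitSteps
  have h4 := h'.1.2.1
  have h5 := h.1.1
  have h6 := h'.1.1
  by_cases himm : p < r ∧ s < q ∧ lam.height r = lam.height p + 1
  · -- The second circle lies immediately inside of the first one: the path passes through the
    -- weight obtained from `μ` at its circle on `p` and `r`.
    obtain ⟨i1, i2, i3⟩ := himm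
    have e : IsExc μ.height p r := by
      refine ⟨i1, ?_, fun j j1 j2 => ?_⟩
      · have := h'.2 p
        have := h'.2 (r + 1)
        omega
      · have := h'.2 p
        have := h'.2 j
        have := h.1.2.2 j j1
        omega
    obtain ⟨ν, C, hC1, hC2⟩ := μ.exists_up e
    have c := C.up
    rw [hC1, hC2] at c
    refine ⟨ν, ?_, Weight.Adj.symm ⟨s, q, Or.inl ⟨⟨i2, ?_, fun j j1 j2 => ?_⟩, fun j => ?_⟩⟩,
      c.adj.symm⟩
    · rintro rfl
      exact c.asymm h'
    · have := c.2 (q + 1)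
      have := c.2 s
      have := h'.2 (q + 1)
      have := h'.2 s
      have := h'.1.step_right lam.unitSteps
      omega
    · have := c.2 j
      have := c.2 s
      have := h'.2 j
      have := h'.2 s
      have := h'.1.step_right lam.unitSteps
      have := h.1.2.2 j
      omega
    · have := c.2 j
      have := h.2 j
      have := h'.2 j
      omega
  · have hcases : q < r ∨ (p < r ∧ s < q) := by
      rcases h.1.trichotomy lam.unitSteps h'.1 with ⟨rfl, rfl⟩ | h7
      · exact absurd (h.eq_of_left h') hne
      · omega
    have e : IsExc κ.height r s := by
      refine ⟨h6, ?_, fun j j1 j2 => ?_⟩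
      · have := h.2 r
        have := h.2 (s + 1)
        omega
      · have := h.2 r
        have := h.2 j
        have := h'.1.2.2 j
        omega
    obtain ⟨ν, C, hC1, hC2⟩ := κ.exists_up e
    have c := C.up
    rw [hC1, hC2] at c
    refine ⟨ν, ?_, c.adj, Weight.Adj.symm ⟨p, q, Or.inl ⟨⟨h5, ?_, fun j j1 j2 => ?_⟩,
      fun j => ?_⟩⟩⟩
    · rintro rfl
      exact c.asymm h
    · have := h'.2 p
      have := h'.2 (q + 1)
      omega
    · have := h'.2 p
      have := h'.2 j
      have := h.1.2.2 j j1 j2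
      have := h.1.2.2 r
      have := h'.1.2.2 j
      omega
    · have := c.2 j
      have := h.2 j
      have := h'.2 j
      omega

/-- For two distinct ascending arrows into the same weight, there is a second path between their
sources, unless the two valleys of the height function cross each other. -/
theorem Weight.Adj.of_up_down {κ ν ξ : Weight m n} {p q r s : ℕ} (h : κ.Up ν p q)
    (h' : ξ.Up ν r s) (hne : κ ≠ ξ) : (p < r ∧ r < q ∧ q < s) ∨ (r < p ∧ p < s ∧ s < q) ∨
      ∃ lam, lam ≠ ν ∧ κ.Adj lam ∧ lam.Adj ξ := by
  wlog hpr : p < r ∨ (p = r ∧ q ≤ s) generalizing κ ξ p q r s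
  · rcases this h' h hne.symm (by omega) with h1 | h1 | ⟨ν, h1, h2, h3⟩
    · exact Or.inr (Or.inl h1)
    · exact Or.inl h1
    · exact Or.inr (Or.inr ⟨ν, h1, h3.symm, h2.symm⟩)
  obtain ⟨v1, v2, v3, v4, v5⟩ := h.isVal
  obtain ⟨w1, w2, w3, w4, w5⟩ := h'.isVal
  have u1 := ν.unitSteps p
  have u2 := ν.unitSteps q
  have u3 := ν.unitSteps r
  have u4 := ν.unitSteps s
  have hqr : q ≠ r := by
    rintro rfl
    omega
  rcases eq_or_ne p r with rfl | hpr'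
  · have hqs : q < s := by
      rcases eq_or_ne q s with rfl | hqs
      · exact absurd (Weight.ext_height fun j => by have := h.2 j; have := h'.2 j; omega) hne
      · omega
    right; right
    -- Between `q` and `s` the height function has a circle of `ν` starting at `q`. Starting from `ξ`,
    -- exchange `q` and `u`, and then `u` and `s`.
    obtain ⟨u, hu1, hu2, hu3⟩ := ν.unitSteps.exists_right (x := q) (z := s) hqs (by
      have := w5 q (by omega) (by omega)
      omega) (by omega)
    have hu4 := hu3.2.1
    have hu5 := hu3.step_right ν.unitSteps
    have e : IsExc ξ.height q u := by
      refine ⟨hu1, ?_, fun j j1 j2 => ?_⟩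
      · have := h'.2 q
        have := h'.2 (u + 1)
        omega
      · have := h'.2 q
        have := h'.2 j
        have := hu3.2.2 j j1 j2
        omega
    obtain ⟨η, C, hC1, hC2⟩ := ξ.exists_up e
    have c := C.up
    rw [hC1, hC2] at c
    refine ⟨η, ?_, Weight.Adj.symm ⟨u, s, Or.inl ⟨⟨hu2, ?_, fun j j1 j2 => ?_⟩, fun j => ?_⟩⟩,
      c.adj.symm⟩
    · rintro rfl
      have := (c.unique h').1
      omega
    · have := c.2 u
      have := c.2 (s + 1)
      have := h'.2 u
      have := h'.2 (s + 1)
      omega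
    · have := c.2 u
      have := c.2 j
      have := h'.2 u
      have := h'.2 j
      have := w5 j
      omega
    · have := c.2 j
      have := h.2 j
      have := h'.2 j
      omega
  -- Disjoint and nested valleys may be filled in any order.
  have hfill : q < r ∨ (p < r ∧ s < q) → ∃ lam, lam ≠ ν ∧ κ.Adj lam ∧ lam.Adj ξ := by
    intro hcases
    obtain ⟨lam, c⟩ := κ.exists_up_of_isVal (p := r) (q := s) (by
      have := h.2 r
      have := h.2 s
      have := h.2 (r + 1)
      have := h.2 (s + 1)
      refine ⟨w1, by omega, by omega, by omega, fun j j1 j2 => ?_⟩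
      have := h.2 j
      have := w5 j j1 j2
      omega)
    refine ⟨lam, ?_, c.adj.symm, ⟨p, q, Or.inl ⟨⟨v1, ?_, fun j j1 j2 => ?_⟩, fun j => ?_⟩⟩⟩
    · rintro rfl
      exact c.asymm h
    · have := h.2 p
      have := h.2 (q + 1)
      have := c.2 p
      have := c.2 (q + 1)
      omega
    · have := h.2 p
      have := h.2 j
      have := c.2 p
      have := c.2 j
      have := h.1.2.2 j j1 j2
      omega
    · have := c.2 j
      have := h.2 j
      have := h'.2 j
      omega
  rcases lt_trichotomy q s with hqs | rfl | hqs
  · rcases Nat.lt_or_ge r q with hrq | hrq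
    · exact Or.inl ⟨by omega, hrq, hqs⟩
    · exact Or.inr (Or.inr (hfill (by omega)))
  · right; right
    obtain ⟨t, ht1, ht2, ht3⟩ := ν.unitSteps.exists_left (x := r) (z := p + 1) (by omega) (by
      have := w5 (r + 1) (by omega) (by omega)
      have := v5 (r + 1) (by omega) (by omega)
      omega) (by omega)
    have ht4 := ht3.2.1
    have ht5 := ht3.step_left ν.unitSteps
    have e : IsExc κ.height t r := by
      refine ⟨ht2, ?_, fun j j1 j2 => ?_⟩
      · have := h.2 t
        have := h.2 (r + 1)
        omega
      · have := h.2 t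
        have := h.2 j
        have := ht3.2.2 j j1 j2
        omega
    obtain ⟨η, C, hC1, hC2⟩ := κ.exists_up e
    have c := C.up
    rw [hC1, hC2] at c
    refine ⟨η, ?_, c.adj, ⟨p, t, Or.inl ⟨⟨by omega, ?_, fun j j1 j2 => ?_⟩, fun j => ?_⟩⟩⟩
    · rintro rfl
      have := (c.unique h).1
      omega
    · have := c.2 p
      have := c.2 (t + 1)
      have := h.2 p
      have := h.2 (t + 1)
      have := w5 (r + 1) (by omega) (by omega)
      have := v5 (r + 1) (by omega) (by omega)
      omega
    · have := c.2 p
      have := c.2 j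
      have := h.2 p
      have := h.2 j
      have := v5 j j1
      omega
    · have := c.2 j
      have := h.2 j
      have := h'.2 j
      omega
  · exact Or.inr (Or.inr (hfill (by omega)))

/-- Two crossing valleys of the height function contain a circle each, and they form the
configuration in which there is only one path of length two. -/
theorem caseD_of_lt {κ ν ξ : Weight m n} (C : Raise κ ν) (D : Raise ξ ν) (h1 : C.1.1 < D.1.1)
    (h2 : D.1.1 < C.1.2) (h3 : C.1.2 < D.1.2) : CaseD C D := by
  have h := C.up
  have h' := D.up
  obtain ⟨v1, v2, v3, v4, v5⟩ := h.isVal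
  obtain ⟨w1, w2, w3, w4, w5⟩ := h'.isVal
  simp only [Fin.lt_def] at h1 h2 h3
  obtain ⟨t, ht1, ht2, ht3⟩ := ν.unitSteps.exists_left (x := D.1.1) (z := C.1.1 + 1) (by omega) (by
    have := v5 (D.1.1 + 1) (by omega) (by omega)
    omega) (by omega)
  obtain ⟨u, hu1, hu2, hu3⟩ := ν.unitSteps.exists_right (x := C.1.2) (z := D.1.2) h3 (by
    have := w5 C.1.2 (by omega) (by omega)
    omega) (by omega)
  have hN := D.1.1.2
  have hN' := D.1.2.2
  refine ⟨C.1.1, ⟨t, by omega⟩, D.1.1, C.1.2, ⟨u, by omega⟩, D.1.2, ?_, ?_, ?_, ?_, ?_, rfl, ?_,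
    rfl, ?_, ?_, ?_⟩
  · exact ht1
  · exact ht2
  · exact h2
  · exact hu1
  · exact hu2
  · rw [κ.isCircle_iff]
    refine ⟨ht2, ?_, fun j j1 j2 => ?_⟩
    · have := h.2 t
      have := h.2 (D.1.1 + 1)
      have := ht3.2.1
      simp only []
      omega
    · simp only [] at j1 j2 ⊢
      have := h.2 t
      have := h.2 j
      have := ht3.2.2 j j1 j2
      omega
  · rw [ξ.isCircle_iff]
    refine ⟨hu1, ?_, fun j j1 j2 => ?_⟩
    · have := h'.2 C.1.2
      have := h'.2 (u + 1)
      have := hu3.2.1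
      simp only []
      omega
    · simp only [] at j1 j2 ⊢
      have := h'.2 C.1.2
      have := h'.2 j
      have := hu3.2.2 j j1 j2
      omega
  · exact (ν.isCircle_iff _).2 ht3
  · exact (ν.isCircle_iff _).2 hu3

/-! ### Paths of length two: the special configurations -/

theorem Weight.not_isRay_iff (w : Weight m n) (i : Fin (m + n)) :
    ¬ w.IsRay i ↔ ∃ x : ℕ, IsExc w.height x i ∨ IsExc w.height i x := by
  constructor
  · intro h
    simp only [Weight.IsRay, not_forall] at h
    obtain ⟨C, hC, h⟩ := h
    rw [w.isCircle_iff] at hC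
    by_cases h1 : C.1 = i
    · exact ⟨C.2, Or.inr (h1 ▸ hC)⟩
    · by_cases h2 : C.2 = i
      · exact ⟨C.1, Or.inl (h2 ▸ hC)⟩
      · exact absurd ⟨h1, h2⟩ h
  · rintro ⟨x, hx | hx⟩ h
    · have := hx.1
      exact (h ⟨⟨x, by omega⟩, i⟩ ((w.isCircle_iff _).2 hx)).2 rfl
    · exact (h ⟨i, ⟨x, hx.right_lt⟩⟩ ((w.isCircle_iff _).2 hx)).1 rfl

theorem Weight.isRay_of_down {w : Weight m n} {i : Fin (m + n)}
    (hi : w.height i < w.height (i + 1)) (h : ∀ x, ¬ IsExc w.height i x) : w.IsRay i := by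
  by_contra hcon
  obtain ⟨x, hx | hx⟩ := (w.not_isRay_iff i).1 hcon
  · have := hx.step_right w.unitSteps
    omega
  · exact h x hx

theorem Weight.isRay_of_up {w : Weight m n} {i : Fin (m + n)}
    (hi : w.height (i + 1) < w.height i) (h : ∀ x, ¬ IsExc w.height x i) : w.IsRay i := by
  by_contra hcon
  obtain ⟨x, hx | hx⟩ := (w.not_isRay_iff i).1 hcon
  · exact h x hx
  · have := hx.step_left w.unitSteps
    omega

/-- In case (a), the half-line at `p₃` in `e_κ` forces the other half-lines. -/
theorem caseA_of_ray {κ ν μ : Weight m n} (C : Raise κ ν) (D : Raise ν μ) (hCD : C.1.2 = D.1.1)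
    (hr : ∀ x, ¬ IsExc κ.height x D.1.2) : CaseA C D := by
  have h := C.up
  have h' := D.up
  have hCD' : (C.1.2 : ℕ) = D.1.1 := by rw [hCD]
  rw [hCD'] at h
  obtain ⟨v1, v2, v3, v4, v5⟩ := h.isVal
  obtain ⟨w1, w2, w3, w4, w5⟩ := h'.isVal
  have h1 := h.1.step_left κ.unitSteps
  have h0 := h.1.2.1
  have h0' := h'.1.2.1
  have h2 := h.1.step_right κ.unitSteps
  have h3 := h'.1.step_left ν.unitSteps
  have h4 := h'.1.step_right ν.unitSteps
  have h5 := h'.2 C.1.1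
  have h6 := h'.2 (C.1.1 + 1)
  have h7 := h.2 (D.1.2 + 1)
  have h8 := h.2 D.1.2
  have h9 := h.2 C.1.1
  -- Since no circle of `κ` ends at `D.1.2`, the height function of `κ` stays above its value after
  -- this point.
  have hκ : ∀ z, z ≤ (D.1.2 : ℕ) → κ.height (D.1.2 + 1) < κ.height z := by
    intro z hz
    by_contra hcon
    obtain ⟨y, -, -, hy⟩ := κ.unitSteps.exists_left hz (by omega) (by omega)
    exact hr y hy
  refine ⟨C.1.1, C.1.2, D.1.2, rfl, by rw [hCD], κ.isRay_of_up (by omega) hr,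
    ν.isRay_of_up (by omega) ?_, μ.isRay_of_up (by omega) ?_, μ.isRay_of_up ?_ ?_⟩
  · intro x hx
    have := hx.1
    have := hx.2.1
    have := hκ x
    have := h.2 x
    omega
  · intro x hx
    have := hx.1
    have := hx.2.1
    have := hκ x
    have := h.2 x
    have := h'.2 x
    omega
  · rw [hCD']
    omega
  · intro x hx
    rw [hCD'] at hx
    have := hx.1
    have := hx.2.1
    have := hκ x
    have := h.2 x
    have := h'.2 x
    have := h.1.2.2 x
    have := h.2 (D.1.1 + 1)
    have := h'.2 (D.1.1 + 1)
    omega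

/-- In case (b), the half-line at `p₁` in `e_κ` forces the other half-lines. -/
theorem caseB_of_ray {κ ν μ : Weight m n} (C : Raise κ ν) (D : Raise ν μ) (hCD : D.1.2 = C.1.1)
    (hr : ∀ x, ¬ IsExc κ.height D.1.1 x) : CaseB C D := by
  have h := C.up
  have h' := D.up
  have hCD' : (D.1.2 : ℕ) = C.1.1 := by rw [hCD]
  rw [hCD'] at h'
  obtain ⟨v1, v2, v3, v4, v5⟩ := h.isVal
  obtain ⟨w1, w2, w3, w4, w5⟩ := h'.isVal
  have h1 := h.1.step_left κ.unitSteps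
  have h0 := h.1.2.1
  have h0' := h'.1.2.1
  have h2 := h.1.step_right κ.unitSteps
  have h3 := h'.1.step_left ν.unitSteps
  have h4 := h'.1.step_right ν.unitSteps
  have h5 := h'.2 C.1.2
  have h6 := h'.2 (C.1.2 + 1)
  have h7 := h.2 (D.1.1 + 1)
  have h8 := h.2 D.1.1
  have h9 := h.2 C.1.2
  have h10 := h.2 (C.1.2 + 1)
  have hκ : ∀ z, (D.1.1 : ℕ) < z → κ.height D.1.1 < κ.height z := by
    intro z hz
    by_contra hcon
    obtain ⟨y, -, -, hy⟩ := κ.unitSteps.exists_right hz (by omega) (by omega)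
    exact hr y hy
  refine ⟨D.1.1, C.1.1, C.1.2, rfl, by rw [← hCD], κ.isRay_of_down (by omega) hr,
    ν.isRay_of_down (by omega) ?_, μ.isRay_of_down ?_ ?_, μ.isRay_of_down (by omega) ?_⟩
  · intro x hx
    have := hx.1
    have := hx.2.1
    have := hκ (x + 1)
    have := h.2 (x + 1)
    omega
  · omega
  · intro x hx
    have := hx.1
    have := hx.2.1
    have := hκ (x + 1)
    have := h.2 (x + 1)
    have := h'.2 (x + 1)
    have := h'.2 C.1.1
    have := h.2 C.1.1
    have := h.1.2.2 (x + 1)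
    omega
  · intro x hx
    have := hx.1
    have := hx.2.1
    have := hκ (x + 1)
    have := h.2 (x + 1)
    have := h'.2 (x + 1)
    omega

/-- A circle whose height exceeds that of a surrounding circle by one lies immediately inside. -/
theorem caseC_of_height {κ ν μ : Weight m n} (C : Raise κ ν) (D : Raise ν μ)
    (e : IsExc κ.height D.1.1 D.1.2) (h1 : C.1.1 < D.1.1) (h2 : D.1.2 < C.1.2)
    (h3 : κ.height D.1.1 = κ.height C.1.1 + 1) : CaseC C D := by
  refine ⟨(κ.isCircle_iff _).2 e, ⟨h1, h2⟩, ?_⟩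
  rintro ⟨E, hE, ⟨h4, h5⟩, h6, h7⟩
  rw [κ.isCircle_iff] at hE
  simp only [Fin.lt_def] at h4 h5 h6 h7
  have := hE.1
  have := C.up.1.2.2 E.1 h4 (by omega)
  have := hE.2.2 D.1.1 h6 (by have := e.1; omega)
  omega

/-- In case (c) the heights at the two nested circles differ by one, since otherwise there would be
a circle between them. -/
theorem CaseC.height_eq {κ ν μ : Weight m n} {C : Raise κ ν} {D : Raise ν μ} (h : CaseC C D) :
    IsExc κ.height D.1.1 D.1.2 ∧ C.1.1 < D.1.1 ∧ D.1.2 < C.1.2 ∧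
      κ.height D.1.1 = κ.height C.1.1 + 1 := by
  obtain ⟨h1, ⟨h2, h3⟩, h4⟩ := h
  rw [κ.isCircle_iff] at h1
  refine ⟨h1, h2, h3, ?_⟩
  by_contra hcon
  have := C.up.1.2.2 D.1.1 h2 (by have := h1.1; have := Fin.lt_def.1 h3; omega)
  obtain ⟨a, b, hab, ha1, ha2, hb1, hb2⟩ :=
    C.up.1.exists_between κ.unitSteps h1 h2 h3 (by omega)
  have := hab.1
  exact h4 ⟨(⟨a, by omega⟩, ⟨b, hab.right_lt⟩), (κ.isCircle_iff _).2 hab, ⟨ha1, hb2⟩, ⟨ha2, hb1⟩⟩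

theorem Weight.IsRay.not_isExc {w : Weight m n} {i : Fin (m + n)} (h : w.IsRay i) (x : ℕ) :
    ¬ IsExc w.height x i ∧ ¬ IsExc w.height i x := by
  have := (w.not_isRay_iff i).not.1 (not_not.2 h)
  push Not at this
  exact this x

/-- If an interval is the sum of two intervals, then these are adjacent. -/
theorem intervals_add {x y z w p s : ℕ} (hxy : x < y) (hzw : z < w) (hps : p < s)
    (h : ∀ j, (if x < j ∧ j ≤ y then (2 : ℤ) else 0) + (if z < j ∧ j ≤ w then 2 else 0) =
      if p < j ∧ j ≤ s then 2 else 0) : (x = p ∧ y = z ∧ w = s) ∨ (z = p ∧ w = x ∧ y = s) := by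
  wlog hxz : x ≤ z generalizing x y z w
  · exact (this hzw hxy (fun j => by rw [add_comm, h j]) (by omega)).symm
  obtain rfl : x = p := by
    have h1 := h (p + 1)
    have h2 := h (x + 1)
    omega
  obtain rfl : y = z := by
    have h1 := h (z + 1)
    have h2 := h y
    have h3 := h (y + 1)
    have h4 := h s
    omega
  have h1 := h w
  have h2 := h s
  omega
theorem Weight.Up.eq_of_right {κ μ μ' : Weight m n} {p p' q : ℕ} (h : κ.Up μ p q)
    (h' : κ.Up μ' p' q) : μ = μ' := by
  obtain rfl := h.1.left_unique h'.1
  exact h.eq_of_left h'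

/-- If the height functions of `κ` and `μ` differ by one interval, then every path of length two
from `κ` to `μ` starts with an ascending arrow at an end point of this interval. -/
theorem Weight.Adj.up_of_height_eq {κ μ ν : Weight m n} (h1 : κ.Adj ν) (h2 : ν.Adj μ) {p s : ℕ}
    (hps : p < s) (hd : ∀ j, μ.height j = κ.height j - if p < j ∧ j ≤ s then 2 else 0) :
    (∃ y, κ.Up ν p y) ∨ ∃ x, κ.Up ν x s := by
  obtain ⟨x, y, h1⟩ := h1
  obtain ⟨z, w, h2⟩ := h2
  rcases h1 with h1 | h1 <;> rcases h2 with h2 | h2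
  · rcases intervals_add h1.1.1 h2.1.1 hps (fun j => by
      have := h1.2 j
      have := h2.2 j
      have := hd j
      omega) with ⟨rfl, rfl, rfl⟩ | ⟨rfl, rfl, rfl⟩
    · exact Or.inl ⟨_, h1⟩
    · exact Or.inr ⟨_, h1⟩
  · rcases intervals_add h2.1.1 hps h1.1.1 (fun j => by
      have := h1.2 j
      have := h2.2 j
      have := hd j
      omega) with ⟨rfl, rfl, rfl⟩ | ⟨rfl, rfl, rfl⟩
    · exact Or.inr ⟨_, h1⟩
    · exact Or.inl ⟨_, h1⟩
  · rcases intervals_add h1.1.1 hps h2.1.1 (fun j => by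
      have := h1.2 j
      have := h2.2 j
      have := hd j
      omega) with ⟨rfl, rfl, rfl⟩ | ⟨rfl, rfl, rfl⟩
    · have := h1.1.right_unique h2.1
      omega
    · have := h1.1.left_unique h2.1
      omega
  · have := h1.2 s
    have := h2.2 s
    have := hd s
    omega

/-- In case (a) there is only one path of length two. -/
theorem CaseA.middle_unique {κ ν μ ν' : Weight m n} {C : Raise κ ν} {D : Raise ν μ}
    (h : CaseA C D) (h1 : κ.Adj ν') (h2 : ν'.Adj μ) : ν' = ν := by
  obtain ⟨p, q, s, hC, hD, hs, -⟩ := h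
  have c := C.up
  have d := D.up
  rw [hC] at c
  rw [hD] at d
  simp only [] at c d
  have hpq := c.1.1
  have hqs := d.1.1
  rcases h1.up_of_height_eq h2 (p := p) (s := s) (by omega) (fun j => by
    have := c.2 j
    have := d.2 j
    omega) with ⟨y, h3⟩ | ⟨x, h3⟩
  · exact h3.eq_of_left c
  · exact ((hs.not_isExc x).1 h3.1).elim

/-- In case (b) there is only one path of length two. -/
theorem CaseB.middle_unique {κ ν μ ν' : Weight m n} {C : Raise κ ν} {D : Raise ν μ}
    (h : CaseB C D) (h1 : κ.Adj ν') (h2 : ν'.Adj μ) : ν' = ν := by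
  obtain ⟨p, q, s, hC, hD, hp, -⟩ := h
  have c := C.up
  have d := D.up
  rw [hC] at c
  rw [hD] at d
  simp only [] at c d
  have hqs := c.1.1
  have hpq := d.1.1
  rcases h1.up_of_height_eq h2 (p := p) (s := s) (by omega) (fun j => by
    have := c.2 j
    have := d.2 j
    omega) with ⟨y, h3⟩ | ⟨x, h3⟩
  · exact ((hp.not_isExc y).2 h3.1).elim
  · exact h3.eq_of_right c

/-- In case (c) there is only one path of length two. -/
theorem CaseC.middle_unique {κ ν μ ν' : Weight m n} {C : Raise κ ν} {D : Raise ν μ}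
    (h : CaseC C D) (h1 : κ.Adj ν') (h2 : ν'.Adj μ) : ν' = ν := by
  obtain ⟨e, hpr, hsq, hi⟩ := h.height_eq
  have c := C.up
  have d := D.up
  simp only [Fin.lt_def] at hpr hsq
  generalize (C.1.1 : ℕ) = p at *
  generalize (C.1.2 : ℕ) = q at *
  generalize (D.1.1 : ℕ) = r at *
  generalize (D.1.2 : ℕ) = s at *
  have hd : ∀ j, μ.height j =
      κ.height j - (if p < j ∧ j ≤ q then 2 else 0) - if r < j ∧ j ≤ s then 2 else 0 := by
    intro j
    have := c.2 j
    have := d.2 j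
    omega
  have hrs := e.1
  obtain ⟨x, y, h1⟩ := h1
  obtain ⟨z, w, h2⟩ := h2
  rcases h1 with h1 | h1 <;> rcases h2 with h2 | h2
  · have hp := hd p
    have hp1 := h1.2 p
    have hp2 := h2.2 p
    have hp' := hd (p + 1)
    have hp1' := h1.2 (p + 1)
    have hp2' := h2.2 (p + 1)
    have hs := hd s
    have hs1 := h1.2 s
    have hs2 := h2.2 s
    rcases eq_or_ne x p with rfl | hxp
    · exact h1.eq_of_left c
    · -- Otherwise the inner pair would be exchanged first, after which the outer pair does not
      -- form a circle any more.
      exfalso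
      obtain rfl : z = p := by omega
      obtain rfl : x = r := by
        have := hd r
        have := h1.2 r
        have := h2.2 r
        have := hd (r + 1)
        have := h1.2 (r + 1)
        have := h2.2 (r + 1)
        have := hd (x + 1)
        have := h1.2 (x + 1)
        have := h2.2 (x + 1)
        have := h1.1.1
        have := h2.1.1
        omega
      have := h2.1.2.2 (x + 1) (by omega) (by omega)
      have := h1.2 (x + 1)
      have := h1.2 z
      have := e.step_left κ.unitSteps
      have := h1.1.1
      omega
  all_goals
    have := hd s
    have := h1.2 s
    have := h2.2 s
    omega

/-- In case (d) there is only one path of length two. -/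
theorem CaseD.middle_unique {κ ν ξ ν' : Weight m n} {C : Raise κ ν} {D : Raise ξ ν}
    (h : CaseD C D) (h1 : κ.Adj ν') (h2 : ν'.Adj ξ) : ν' = ν := by
  obtain ⟨p, p₂, r, q, p₅, s, i1, i2, i3, i4, i5, hC, -, hD, -⟩ := h
  have c := C.up
  have d := D.up
  rw [hC] at c
  rw [hD] at d
  have hpr : (p : ℕ) < r := i1.trans i2
  have hrq : (r : ℕ) < q := i3
  have hqs : (q : ℕ) < s := i4.trans i5
  simp only [] at c d
  clear i1 i2 i3 i4 i5 hC hD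
  generalize (p : ℕ) = p at *
  generalize (q : ℕ) = q at *
  generalize (r : ℕ) = r at *
  generalize (s : ℕ) = s at *
  have hd : ∀ j, ξ.height j =
      κ.height j - (if p < j ∧ j ≤ r then 2 else 0) + if q < j ∧ j ≤ s then 2 else 0 := by
    intro j
    have := c.2 j
    have := d.2 j
    omega
  obtain ⟨x, y, h1⟩ := h1
  obtain ⟨z, w, h2⟩ := h2
  have e1 : ∀ κ μ : Weight m n, κ.Up μ x y → x < y := fun _ _ h => h.1.1
  have e2 : ∀ κ μ : Weight m n, κ.Up μ z w → z < w := fun _ _ h => h.1.1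
  have hr := hd r
  have hs := hd s
  rcases h1 with h1 | h1 <;> rcases h2 with h2 | h2
  · have := h1.2 s
    have := h2.2 s
    omega
  · rcases eq_or_ne x p with rfl | hxp
    · exact h1.eq_of_left c
    · exfalso
      have hxy := h1.1.1
      have hzw := h2.1.1
      have := hd p
      have := hd (p + 1)
      have := h1.2 p
      have := h1.2 (p + 1)
      have := h2.2 p
      have := h2.2 (p + 1)
      have := h1.2 s
      have := h2.2 s
      have := hd (x + 1)
      have := h1.2 (x + 1)
      have := h2.2 (x + 1)
      omega
  · exfalso
    have hxy := h1.1.1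
    have hzw := h2.1.1
    have hsum : ∀ j, (if x < j ∧ j ≤ y then (2 : ℤ) else 0) + (if p < j ∧ j ≤ r then 2 else 0) =
        (if z < j ∧ j ≤ w then 2 else 0) + (if q < j ∧ j ≤ s then 2 else 0) := by
      intro j
      have := hd j
      have := h1.2 j
      have := h2.2 j
      omega
    have hxz : x ≠ z := by
      rintro rfl
      obtain rfl := h1.1.right_unique h2.1
      have := hsum s
      omega
    have hyw : y ≠ w := by
      rintro rfl
      exact hxz (h1.1.left_unique h2.1)
    obtain rfl : z = p := by
      have := hsum (p + 1)
      have := hsum (x + 1)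
      have := hsum (z + 1)
      omega
    obtain rfl : y = s := by
      have := hsum s
      have := hsum y
      have := hsum w
      omega
    have hsum1 := hsum (x + 1)
    have hsum2 := hsum w
    have hsum3 := hsum r
    have hsum4 := hsum (r + 1)
    have hsum5 := hsum (q + 1)
    have hsum6 := hsum q
    have hw : (x = r ∧ w = q) ∨ (x = q ∧ w = r) := by omega
    rcases hw with ⟨rfl, rfl⟩ | ⟨rfl, rfl⟩
    · have := h1.1.trichotomy ν'.unitSteps h2.1
      omega
    · have := h2.1.2.1
      have := c.1.2.2 (w + 1) (by omega) (by omega)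
      have := h1.2 (w + 1)
      have := h1.2 z
      omega
  · have := h1.2 r
    have := h2.2 r
    omega

/-! ### Classification of the pairs of distinct vertices with a single path of length two -/

/-- The path from `a` through `c` to `b` is one of the ascending and descending paths of
cases (a) and (b). -/
def IsMonomial (a c b : Weight m n) : Prop :=
  (∃ (C : Raise a c) (D : Raise c b), CaseA C D ∨ CaseB C D) ∨
    ∃ (C : Raise b c) (D : Raise c a), CaseA C D ∨ CaseB C D

/-- The path from `a` through `c` to `b` is one of the paths of cases (c) and (d). -/
def IsDualMonomial (a c b : Weight m n) : Prop :=
  ((∃ (C : Raise a c) (D : Raise c b), CaseC C D) ∨ ∃ (C : Raise b c) (D : Raise c a), CaseC C D) ∨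
    ((∃ (C : Raise a c) (D : Raise b c), CaseD C D) ∨ ∃ (C : Raise b c) (D : Raise a c), CaseD C D)

theorem IsMonomial.middle_unique {a c b c' : Weight m n} (h : IsMonomial a c b) (h1 : a.Adj c')
    (h2 : c'.Adj b) : c' = c := by
  rcases h with ⟨C, D, h | h⟩ | ⟨C, D, h | h⟩
  · exact h.middle_unique h1 h2
  · exact h.middle_unique h1 h2
  · exact h.middle_unique h2.symm h1.symm
  · exact h.middle_unique h2.symm h1.symm

theorem IsDualMonomial.middle_unique {a c b c' : Weight m n} (h : IsDualMonomial a c b)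
    (h1 : a.Adj c') (h2 : c'.Adj b) : c' = c := by
  rcases h with (⟨C, D, h⟩ | ⟨C, D, h⟩) | (⟨C, D, h⟩ | ⟨C, D, h⟩)
  · exact h.middle_unique h1 h2
  · exact h.middle_unique h2.symm h1.symm
  · exact h.middle_unique h1 h2
  · exact h.middle_unique h2.symm h1.symm

theorem Raise.asymm {κ μ : Weight m n} (C : Raise κ μ) (D : Raise μ κ) : False :=
  C.up.asymm D.up

theorem IsMonomial.ne {a c b : Weight m n} (h : IsMonomial a c b) : a ≠ b := by
  rintro rfl
  rcases h with ⟨C, D, -⟩ | ⟨C, D, -⟩ <;> exact C.asymm D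

theorem IsDualMonomial.ne {a c b : Weight m n} (h : IsDualMonomial a c b) : a ≠ b := by
  have key : ∀ {κ ν : Weight m n} (C D : Raise κ ν), ¬ CaseD C D := by
    rintro κ ν C D ⟨p₁, p₂, p₃, p₄, p₅, p₆, h1, h2, -, -, -, h3, -, h4, -⟩
    rw [Subsingleton.elim C D, h4, Prod.mk.injEq] at h3
    exact absurd (h1.trans h2) (by rw [h3.1]; exact lt_irrefl _)
  rintro rfl
  rcases h with (⟨C, D, -⟩ | ⟨C, D, -⟩) | (⟨C, D, h⟩ | ⟨C, D, h⟩)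
  · exact C.asymm D
  · exact C.asymm D
  · exact key C D h
  · exact key C D h

theorem IsMonomial.not_isDualMonomial {a c b : Weight m n} (h : IsMonomial a c b) :
    ¬ IsDualMonomial a c b := by
  -- In cases (a) and (b) the two circles share a point, in case (c) they are disjoint.
  have key : ∀ {κ ν μ : Weight m n} (C : Raise κ ν) (D : Raise ν μ), CaseC C D →
      ¬ (CaseA C D ∨ CaseB C D) := by
    rintro κ ν μ C D ⟨h1, ⟨h2, h3⟩, -⟩ (⟨p₁, p₂, p₃, hC, hD, -⟩ | ⟨p₁, p₂, p₃, hC, hD, -⟩)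
    all_goals
      have := ((κ.isCircle_iff _).1 h1).1
      rw [hC, hD] at h2 h3
      rw [hD] at this
      simp only [Fin.lt_def] at *
      omega
  intro h'
  rcases h with ⟨C, D, h⟩ | ⟨C, D, h⟩ <;>
    rcases h' with (⟨C', D', h'⟩ | ⟨C', D', h'⟩) | (⟨C', D', h'⟩ | ⟨C', D', h'⟩)
  · exact key C D (by rwa [Subsingleton.elim C C', Subsingleton.elim D D']) h
  · exact C.asymm D'
  · exact D.asymm D'
  · exact D.asymm C'
  · exact C.asymm D'
  · exact key C D (by rwa [Subsingleton.elim C C', Subsingleton.elim D D']) h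
  · exact D.asymm C'
  · exact D.asymm D'

/-- A path of length two with distinct end points either belongs to one of the special
configurations or is not the only one. -/
theorem Weight.Adj.classification {a c b : Weight m n} (h1 : a.Adj c) (h2 : c.Adj b)
    (hab : a ≠ b) :
    IsMonomial a c b ∨ IsDualMonomial a c b ∨ ∃ c', c' ≠ c ∧ a.Adj c' ∧ c'.Adj b := by
  have hup : ∀ {κ ν μ : Weight m n} (C : Raise κ ν) (D : Raise ν μ),
      (CaseA C D ∨ CaseB C D) ∨ CaseC C D ∨ ∃ ν', ν' ≠ ν ∧ κ.Adj ν' ∧ ν'.Adj μ := by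
    intro κ ν μ C D
    rcases Weight.Adj.of_up_up C.up D.up with ⟨h1, h2⟩ | ⟨h1, h2⟩ | ⟨h1, h2, h3, h4⟩ | h
    · exact Or.inl (Or.inl (caseA_of_ray C D (Fin.ext h1) h2))
    · exact Or.inl (Or.inr (caseB_of_ray C D (Fin.ext h1) h2))
    · exact Or.inr (Or.inl (caseC_of_height C D h1 h2 h3 h4))
    · exact Or.inr (Or.inr h)
  obtain ⟨f⟩ := Weight.adj_iff.1 h1
  obtain ⟨g⟩ := Weight.adj_iff.1 h2
  rcases f with C | C <;> rcases g with D | D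
  · rcases hup C D with h | h | h
    · exact Or.inl (Or.inl ⟨C, D, h⟩)
    · exact Or.inr (Or.inl (Or.inl (Or.inl ⟨C, D, h⟩)))
    · exact Or.inr (Or.inr h)
  · rcases Weight.Adj.of_up_down C.up D.up hab with ⟨h1, h2, h3⟩ | ⟨h1, h2, h3⟩ | h
    · exact Or.inr (Or.inl (Or.inr (Or.inl ⟨C, D, caseD_of_lt C D h1 h2 h3⟩)))
    · exact Or.inr (Or.inl (Or.inr (Or.inr ⟨D, C, caseD_of_lt D C h1 h2 h3⟩)))
    · exact Or.inr (Or.inr h)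
  · exact Or.inr (Or.inr (Weight.Adj.of_down_up C.up D.up hab))
  · rcases hup D C with h | h | ⟨ν', h1, h2, h3⟩
    · exact Or.inl (Or.inr ⟨D, C, h⟩)
    · exact Or.inr (Or.inl (Or.inl (Or.inr ⟨D, C, h⟩)))
    · exact Or.inr (Or.inr ⟨ν', h1, h3.symm, h2.symm⟩)

end ArcAlg

/-! ### The pairing of path algebras in degree two -/

namespace QuiverAlg

universe u v w
variable {k : Type w} {V : Type u} [Field k] [Quiver.{v} V]

open PathAlgebra

theorem pairing_add_left (f f' : PathAlgebra k V) (g : PathAlgebra k Vᵒᵖ) :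
    pairing (f + f') g = pairing f g + pairing f' g :=
  Finsupp.sum_add_index' (by simp) (by intros; ring)

theorem pairing_smul_left (r : k) (f : PathAlgebra k V) (g : PathAlgebra k Vᵒᵖ) :
    pairing (r • f) g = r * pairing f g := by
  refine (Finsupp.sum_smul_index (by simp)).trans ?_
  simp only [mul_assoc]
  exact Finsupp.mul_sum _ _ |>.symm

theorem pairing_add_right (f : PathAlgebra k V) (g g' : PathAlgebra k Vᵒᵖ) :
    pairing f (g + g') = pairing f g + pairing f g' := by
  refine Eq.trans ?_ Finsupp.sum_add
  refine Finsupp.sum_congr fun p _ => ?_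
  exact mul_add _ _ _

theorem pairing_smul_right (r : k) (f : PathAlgebra k V) (g : PathAlgebra k Vᵒᵖ) :
    pairing f (r • g) = r * pairing f g := by
  refine Eq.trans ?_ (Finsupp.mul_sum _ _).symm
  refine Finsupp.sum_congr fun p _ => ?_
  exact mul_left_comm _ _ _

variable (k V) in
/-- The pairing as a bilinear map. -/
noncomputable def pairingHom : PathAlgebra k V →ₗ[k] PathAlgebra k Vᵒᵖ →ₗ[k] k :=
  LinearMap.mk₂ k pairing pairing_add_left pairing_smul_left pairing_add_right pairing_smul_right

theorem pairingHom_apply (f : PathAlgebra k V) (g : PathAlgebra k Vᵒᵖ) :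
    pairingHom k V f g = pairing f g := rfl

open Classical in
theorem pairingHom_ofPath {a b : V} (p : Quiver.Path a b) {c d : Vᵒᵖ} (q : Quiver.Path c d) :
    pairingHom k V (ofPath k p) (ofPath k q) =
      if (⟨c, d, q⟩ : PathIn Vᵒᵖ) = ⟨op b, op a, barPath p⟩ then 1 else 0 := by
  rw [pairingHom_apply]
  refine (Finsupp.sum_single_index (by simp)).trans ?_
  rw [one_mul]
  exact Finsupp.single_apply

theorem length_barPath {a b : V} (p : Quiver.Path a b) : (barPath p).length = p.length := by
  induction p with
  | nil => rfl
  | cons p e ih => simp [barPath, ih, Nat.add_comm]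

/-- Paths of length two which do not have the same middle vertex are orthogonal. -/
theorem pairingHom_two_of_ne {a b c : V} (f : a ⟶ b) (g : b ⟶ c) {a' b' c' : Vᵒᵖ} (u : a' ⟶ b')
    (v : b' ⟶ c') (h : a' = op c → b' = op b → c' = op a → False) :
    pairingHom k V (two k f g) (two k u v) = 0 := by
  classical
  unfold two
  rw [pairingHom_ofPath, if_neg]
  intro heq
  simp only [Sigma.mk.injEq] at heq
  obtain ⟨rfl, heq⟩ := heq
  rw [heq_eq_eq, Sigma.mk.injEq] at heq
  obtain ⟨rfl, heq⟩ := heq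
  rw [heq_eq_eq] at heq
  refine h rfl ?_ rfl
  change (Quiver.Path.nil.cons u).cons v = (Quiver.Path.nil.cons g.op).cons f.op at heq
  exact (Quiver.Path.obj_eq_of_cons_eq_cons heq)

theorem pairingHom_two_self {a b c : V} (f : a ⟶ b) (g : b ⟶ c) :
    pairingHom k V (two k f g) (two k g.op f.op) = 1 := by
  classical
  unfold two
  rw [pairingHom_ofPath, if_pos]
  rfl

theorem exists_eq_two {a b : V} (p : Quiver.Path a b) (hp : p.length = 2) :
    ∃ (c : V) (f : a ⟶ c) (g : c ⟶ b), p = f.toPath.comp g.toPath := by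
  match p, hp with
  | .cons (.cons .nil f) g, _ => exact ⟨_, f, g, rfl⟩

theorem two_mem_degreePart {a b c : V} (f : a ⟶ b) (g : b ⟶ c) :
    two k f g ∈ degreePart k V 2 :=
  Submodule.subset_span ⟨a, c, _, rfl, rfl⟩

/-- The span of the paths of length two with given source and target. -/
noncomputable def homogPart (k : Type w) {V : Type u} [Field k] [Quiver.{v} V] (a b : V) :
    Submodule k (PathAlgebra k V) :=
  Submodule.span k {x | ∃ (c : V) (f : a ⟶ c) (g : c ⟶ b), x = two k f g}

theorem two_mem_homogPart {a b c : V} (f : a ⟶ b) (g : b ⟶ c) : two k f g ∈ homogPart k a c :=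
  Submodule.subset_span ⟨b, f, g, rfl⟩

variable (k V) in
/-- The span of the paths of length at least three. -/
noncomputable def longPart : Submodule k (PathAlgebra k V) :=
  Submodule.span k {x | ∃ (a b : V) (p : Quiver.Path a b), 3 ≤ p.length ∧ x = ofPath k p}

theorem ofPath_mul_ofPath_mem_longPart {a b c d : V} (p : Quiver.Path a b) (q : Quiver.Path c d)
    (h : 3 ≤ p.length + q.length) : ofPath k p * ofPath k q ∈ longPart k V := by
  by_cases hcb : c = b
  · subst hcb
    rw [ofPath_mul_ofPath]
    exact Submodule.subset_span ⟨a, d, _, by simpa using h, rfl⟩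
  · rw [ofPath_mul_of_ne _ _ hcb]
    exact zero_mem _

/-- Multiplying a combination of parallel paths of length two by a path either makes all of them
longer, or is the multiplication by a trivial path. -/
theorem ofPath_mul_mem_of_homogPart {a b c d : V} (p : Quiver.Path c d) {r : PathAlgebra k V}
    (hr : r ∈ homogPart k a b) :
    ofPath k p * r ∈ longPart k V ∨ ofPath k p * r = r ∨ ofPath k p * r = 0 := by
  match p with
  | .nil =>
    right
    by_cases h : a = c
    · left
      induction hr using Submodule.span_induction with
      | mem x hx =>
        obtain ⟨e, f, g, rfl⟩ := hx
        subst h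
        unfold two
        rw [ofPath_mul_ofPath, Quiver.Path.nil_comp]
      | zero => exact mul_zero' _
      | add x y _ _ hx hy => rw [mul_add', hx, hy]
      | smul s x _ hx => rw [mul_smul', hx]
    · right
      induction hr using Submodule.span_induction with
      | mem x hx =>
        obtain ⟨e, f, g, rfl⟩ := hx
        exact ofPath_mul_of_ne _ _ h
      | zero => exact mul_zero' _
      | add x y _ _ hx hy => rw [mul_add', hx, hy, add_zero]
      | smul s x _ hx => rw [mul_smul', hx, smul_zero]
  | .cons p e =>
    left
    induction hr using Submodule.span_induction with
    | mem x hx =>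
      obtain ⟨e, f, g, rfl⟩ := hx
      exact ofPath_mul_ofPath_mem_longPart _ _ (by simp)
    | zero => rw [mul_zero']; exact zero_mem _
    | add x y _ _ hx hy => rw [mul_add']; exact add_mem hx hy
    | smul s x _ hx => rw [mul_smul']; exact Submodule.smul_mem _ _ hx

theorem mul_ofPath_mem_of_homogPart {a b c d : V} (p : Quiver.Path c d) {r : PathAlgebra k V}
    (hr : r ∈ homogPart k a b) :
    r * ofPath k p ∈ longPart k V ∨ r * ofPath k p = r ∨ r * ofPath k p = 0 := by
  match p with
  | .nil =>
    right
    by_cases h : c = b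
    · left
      induction hr using Submodule.span_induction with
      | mem x hx =>
        obtain ⟨e, f, g, rfl⟩ := hx
        subst h
        unfold two
        rw [ofPath_mul_ofPath, Quiver.Path.comp_nil]
      | zero => exact zero_mul' _
      | add x y _ _ hx hy => rw [add_mul', hx, hy]
      | smul s x _ hx => rw [PathAlgebra.smul_mul', hx]
    · right
      induction hr using Submodule.span_induction with
      | mem x hx =>
        obtain ⟨e, f, g, rfl⟩ := hx
        exact ofPath_mul_of_ne _ _ h
      | zero => exact zero_mul' _
      | add x y _ _ hx hy => rw [add_mul', hx, hy, add_zero]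
      | smul s x _ hx => rw [PathAlgebra.smul_mul', hx, smul_zero]
  | .cons p e =>
    left
    induction hr using Submodule.span_induction with
    | mem x hx =>
      obtain ⟨e, f, g, rfl⟩ := hx
      exact ofPath_mul_ofPath_mem_longPart _ _ (by simp; omega)
    | zero => rw [zero_mul']; exact zero_mem _
    | add x y _ _ hx hy => rw [add_mul']; exact add_mem hx hy
    | smul s x _ hx => rw [PathAlgebra.smul_mul']; exact Submodule.smul_mem _ _ hx

theorem ofPath_mul_mem_longPart {c d : V} (p : Quiver.Path c d) {x : PathAlgebra k V}
    (hx : x ∈ longPart k V) : ofPath k p * x ∈ longPart k V := by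
  induction hx using Submodule.span_induction with
  | mem x hx =>
    obtain ⟨a, b, q, hq, rfl⟩ := hx
    exact ofPath_mul_ofPath_mem_longPart _ _ (by omega)
  | zero => rw [mul_zero']; exact zero_mem _
  | add x y _ _ hx hy => rw [mul_add']; exact add_mem hx hy
  | smul s x _ hx => rw [mul_smul']; exact Submodule.smul_mem _ _ hx

theorem mul_ofPath_mem_longPart {c d : V} (p : Quiver.Path c d) {x : PathAlgebra k V}
    (hx : x ∈ longPart k V) : x * ofPath k p ∈ longPart k V := by
  induction hx using Submodule.span_induction with
  | mem x hx =>
    obtain ⟨a, b, q, hq, rfl⟩ := hx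
    exact ofPath_mul_ofPath_mem_longPart _ _ (by omega)
  | zero => rw [zero_mul']; exact zero_mem _
  | add x y _ _ hx hy => rw [add_mul']; exact add_mem hx hy
  | smul s x _ hx => rw [PathAlgebra.smul_mul']; exact Submodule.smul_mem _ _ hx

/-- The ideal generated by a set of quadratic relations, each of which is a combination of parallel
paths, lies in the span of these relations and of the longer paths: multiplying a relation by a
trivial path gives the relation or zero. -/
theorem span_le_sup_longPart [Fintype V] {R : Set (PathAlgebra k V)}
    (hR : ∀ r ∈ R, ∃ a b, r ∈ homogPart k a b) {f : PathAlgebra k V}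
    (hf : f ∈ TwoSidedIdeal.span R) : f ∈ Submodule.span k R ⊔ longPart k V := by
  set J := Submodule.span k R ⊔ longPart k V with hJ
  have hlong : longPart k V ≤ J := le_sup_right
  have hleft : ∀ (x y : PathAlgebra k V), y ∈ J → x * y ∈ J := by
    intro x y hy
    induction x using PathAlgebra.induction_on with
    | h0 => rw [zero_mul']; exact zero_mem _
    | hadd x x' hx hx' => rw [add_mul']; exact add_mem hx hx'
    | hsmul s c d p =>
      rw [PathAlgebra.smul_mul']
      refine Submodule.smul_mem _ _ ?_
      obtain ⟨y₁, h₁, y₂, h₂, rfl⟩ := Submodule.mem_sup.1 hy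
      rw [mul_add']
      refine add_mem ?_ (hlong (ofPath_mul_mem_longPart p h₂))
      clear hy
      induction h₁ using Submodule.span_induction with
      | mem r hr =>
        obtain ⟨a, b, hab⟩ := hR r hr
        rcases ofPath_mul_mem_of_homogPart p hab with h | h | h
        · exact hlong h
        · rw [h]; exact Submodule.mem_sup_left (Submodule.subset_span hr)
        · rw [h]; exact zero_mem _
      | zero => rw [mul_zero']; exact zero_mem _
      | add x y _ _ hx hy => rw [mul_add']; exact add_mem hx hy
      | smul s x _ hx => rw [mul_smul']; exact Submodule.smul_mem _ _ hx
  have hright : ∀ (y x : PathAlgebra k V), y ∈ J → y * x ∈ J := by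
    intro y x hy
    induction x using PathAlgebra.induction_on with
    | h0 => rw [mul_zero']; exact zero_mem _
    | hadd x x' hx hx' => rw [mul_add']; exact add_mem hx hx'
    | hsmul s c d p =>
      rw [mul_smul']
      refine Submodule.smul_mem _ _ ?_
      obtain ⟨y₁, h₁, y₂, h₂, rfl⟩ := Submodule.mem_sup.1 hy
      rw [add_mul']
      refine add_mem ?_ (hlong (mul_ofPath_mem_longPart p h₂))
      clear hy
      induction h₁ using Submodule.span_induction with
      | mem r hr =>
        obtain ⟨a, b, hab⟩ := hR r hr
        rcases mul_ofPath_mem_of_homogPart p hab with h | h | h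
        · exact hlong h
        · rw [h]; exact Submodule.mem_sup_left (Submodule.subset_span hr)
        · rw [h]; exact zero_mem _
      | zero => rw [zero_mul']; exact zero_mem _
      | add x y _ _ hx hy => rw [add_mul']; exact add_mem hx hy
      | smul s x _ hx => rw [PathAlgebra.smul_mul']; exact Submodule.smul_mem _ _ hx
  induction hf using TwoSidedIdeal.span_induction with
  | mem x hx => exact Submodule.mem_sup_left (Submodule.subset_span hx)
  | zero => exact zero_mem _
  | add x y _ _ hx hy => exact add_mem hx hy
  | neg x _ hx => exact neg_mem hx
  | left_absorb a x _ hx => exact hleft a x hx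
  | right_absorb b x _ hx => exact hright x b hx

theorem pairingHom_eq_zero_of_longPart {f : PathAlgebra k V} (hf : f ∈ longPart k V)
    {g : PathAlgebra k Vᵒᵖ} (hg : g ∈ degreePart k Vᵒᵖ 2) : pairingHom k V f g = 0 := by
  classical
  induction hf using Submodule.span_induction with
  | zero => simp
  | add x y _ _ hx hy => simp [hx, hy]
  | smul s x _ hx => simp [hx]
  | mem x hx =>
    obtain ⟨a, b, p, hp, rfl⟩ := hx
    induction hg using Submodule.span_induction with
    | zero => simp
    | add x y _ _ hx hy => simp [hx, hy]
    | smul s x _ hx => simp [hx]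
    | mem x hx =>
      obtain ⟨c, d, q, hq, rfl⟩ := hx
      rw [pairingHom_ofPath, if_neg]
      intro heq
      have := congrArg (fun p : PathIn Vᵒᵖ => p.2.2.length) heq
      simp only [length_barPath] at this
      omega

/-- An element of degree two which is orthogonal to a set of quadratic relations is orthogonal to
the ideal which they generate. -/
theorem mem_quadraticPerp_span [Fintype V] {R : Set (PathAlgebra k V)}
    (hR : ∀ r ∈ R, ∃ a b, r ∈ homogPart k a b) {g : PathAlgebra k Vᵒᵖ}
    (hg : g ∈ degreePart k Vᵒᵖ 2) (h : ∀ r ∈ R, pairingHom k V r g = 0) :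
    g ∈ quadraticPerp (TwoSidedIdeal.span R) := by
  refine ⟨hg, fun f hf _ => ?_⟩
  obtain ⟨y₁, h₁, y₂, h₂, rfl⟩ := Submodule.mem_sup.1 (span_le_sup_longPart hR hf)
  rw [← pairingHom_apply, map_add, LinearMap.add_apply, pairingHom_eq_zero_of_longPart h₂ hg,
    add_zero]
  have : Submodule.span k R ≤ LinearMap.ker ((pairingHom k V).flip g) :=
    Submodule.span_le.2 fun r hr => h r hr
  exact this h₁

theorem pairingHom_two_lengthTwo {a b : Vᵒᵖ} (p q : LengthTwo a b) [DecidableEq (LengthTwo a b)] :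
    pairingHom k V (two k q.2.2.unop q.2.1.unop) (two k p.2.1 p.2.2) = if p = q then 1 else 0 := by
  classical
  unfold two
  rw [pairingHom_ofPath]
  congr 1
  obtain ⟨c, u, v⟩ := p
  obtain ⟨c', u', v'⟩ := q
  apply propext
  constructor
  · intro heq
    simp only [Sigma.mk.injEq] at heq
    replace heq := eq_of_heq (Sigma.mk.inj (eq_of_heq heq.2)).2
    change (Quiver.Path.nil.cons u).cons v = (Quiver.Path.nil.cons u').cons v' at heq
    obtain rfl := Quiver.Path.obj_eq_of_cons_eq_cons heq
    obtain rfl := eq_of_heq (Quiver.Path.hom_heq_of_cons_eq_cons heq)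
    have := eq_of_heq (Quiver.Path.heq_of_cons_eq_cons heq)
    obtain rfl := eq_of_heq (Quiver.Path.hom_heq_of_cons_eq_cons this)
    rfl
  · intro heq
    cases heq
    rfl

/-- An element of degree two is determined by its pairings with the paths of length two. -/
theorem eq_sum_pairingHom [Fintype V] [Fintype Vᵒᵖ] [∀ a b : Vᵒᵖ, Fintype (LengthTwo a b)]
    {g : PathAlgebra k Vᵒᵖ} (hg : g ∈ degreePart k Vᵒᵖ 2) :
    g = ∑ a : Vᵒᵖ, ∑ b : Vᵒᵖ, ∑ p : LengthTwo a b,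
      pairingHom k V (two k p.2.2.unop p.2.1.unop) g • two k p.2.1 p.2.2 := by
  classical
  induction hg using Submodule.span_induction with
  | zero => simp
  | add x y _ _ hx hy =>
    simp only [map_add, add_smul, Finset.sum_add_distrib]
    rw [← hx, ← hy]
  | smul s x _ hx =>
    simp only [map_smul, smul_eq_mul, mul_smul, ← Finset.smul_sum]
    rw [← hx]
  | mem x hx =>
    obtain ⟨a, b, q, hq, rfl⟩ := hx
    obtain ⟨c, u, v, rfl⟩ := exists_eq_two q hq
    rw [show ofPath k (u.toPath.comp v.toPath) = two k u v from rfl]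
    rw [Finset.sum_eq_single a, Finset.sum_eq_single b, Finset.sum_eq_single ⟨c, u, v⟩]
    · have := pairingHom_two_lengthTwo (k := k) (⟨c, u, v⟩ : LengthTwo a b) ⟨c, u, v⟩
      rw [if_pos rfl] at this
      rw [this, one_smul]
    · intro p _ hp
      have := pairingHom_two_lengthTwo (k := k) (⟨c, u, v⟩ : LengthTwo a b) p
      rw [if_neg hp.symm] at this
      rw [this, zero_smul]
    · simp
    · intro b' _ hb
      refine Finset.sum_eq_zero fun p _ => ?_
      rw [pairingHom_two_of_ne _ _ _ _ (fun _ _ h => hb h.symm), zero_smul]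
    · simp
    · intro a' _ ha
      refine Finset.sum_eq_zero fun b' _ => Finset.sum_eq_zero fun p _ => ?_
      rw [pairingHom_two_of_ne _ _ _ _ (fun h _ _ => ha h.symm), zero_smul]
    · simp

end QuiverAlg

/-! ### Orthogonality of the two sets of relations -/

namespace ArcAlg

open QuiverAlg
open PathAlgebra (two)

variable {m n : ℕ} {k : Type*} [Field k]

theorem mem_monomialRel_iff {r : PathAlgebra k (Weight m n)} : r ∈ monomialRel k m n ↔
    ∃ (a c b : Weight m n) (f : a ⟶ c) (g : c ⟶ b), IsMonomial a c b ∧ r = two k f g := by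
  constructor
  · rintro ⟨κ, ν, μ, C, D, h, rfl | rfl⟩
    · exact ⟨_, _, _, _, _, Or.inl ⟨C, D, h⟩, rfl⟩
    · exact ⟨_, _, _, _, _, Or.inr ⟨C, D, h⟩, rfl⟩
  · rintro ⟨a, c, b, f, g, ⟨C, D, h⟩ | ⟨C, D, h⟩, rfl⟩
    · rw [Subsingleton.elim f C.x, Subsingleton.elim g D.x]
      exact ⟨_, _, _, C, D, h, Or.inl rfl⟩
    · rw [Subsingleton.elim f D.y, Subsingleton.elim g C.y]
      exact ⟨_, _, _, C, D, h, Or.inr rfl⟩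

theorem mem_dualMonomialRel_iff {r : PathAlgebra k (Weight m n)ᵒᵖ} : r ∈ dualMonomialRel k m n ↔
    ∃ (a c b : Weight m n) (f : a ⟶ c) (g : c ⟶ b), IsDualMonomial a c b ∧
      r = two k g.op f.op := by
  constructor
  · rintro (⟨κ, ν, μ, C, D, h, rfl | rfl⟩ | ⟨κ, ν, μ, C, D, h, rfl | rfl⟩)
    · exact ⟨_, _, _, D.y, C.y, Or.inl (Or.inr ⟨C, D, h⟩), rfl⟩
    · exact ⟨_, _, _, C.x, D.x, Or.inl (Or.inl ⟨C, D, h⟩), rfl⟩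
    · exact ⟨_, _, _, D.x, C.y, Or.inr (Or.inr ⟨C, D, h⟩), rfl⟩
    · exact ⟨_, _, _, C.x, D.y, Or.inr (Or.inl ⟨C, D, h⟩), rfl⟩
  · rintro ⟨a, c, b, f, g, (⟨C, D, h⟩ | ⟨C, D, h⟩) | (⟨C, D, h⟩ | ⟨C, D, h⟩), rfl⟩
    · rw [Subsingleton.elim f C.x, Subsingleton.elim g D.x]
      exact Or.inl ⟨_, _, _, C, D, h, Or.inr rfl⟩
    · rw [Subsingleton.elim f D.y, Subsingleton.elim g C.y]
      exact Or.inl ⟨_, _, _, C, D, h, Or.inl rfl⟩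
    · rw [Subsingleton.elim f C.x, Subsingleton.elim g D.y]
      exact Or.inr ⟨_, _, _, C, D, h, Or.inr rfl⟩
    · rw [Subsingleton.elim f D.x, Subsingleton.elim g C.y]
      exact Or.inr ⟨_, _, _, C, D, h, Or.inl rfl⟩

theorem adj_of_hom {a b : Weight m n} (f : a ⟶ b) : a.Adj b := Weight.adj_iff.2 ⟨f⟩

instance (a b : (Weight m n)ᵒᵖ) : Subsingleton (a ⟶ b) :=
  ⟨fun _ _ => Quiver.Hom.unop_inj (Subsingleton.elim _ _)⟩

theorem lengthTwo_ext {a b : (Weight m n)ᵒᵖ} {p q : LengthTwo a b} (h : p.1 = q.1) : p = q := by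
  obtain ⟨c, u, v⟩ := p
  obtain ⟨d, u', v'⟩ := q
  obtain rfl : c = d := h
  rw [Subsingleton.elim u u', Subsingleton.elim v v']

theorem exists_mem_homogPart {r : PathAlgebra k (Weight m n)}
    (hr : r ∈ monomialRel k m n ∪ commRel k m n ∪ vertexRel k m n) :
    ∃ a b, r ∈ homogPart k a b := by
  rcases hr with (hr | ⟨a, b, p, q, -, rfl⟩) | ⟨lam, κ, D, rfl⟩
  · obtain ⟨a, c, b, f, g, -, rfl⟩ := mem_monomialRel_iff.1 hr
    exact ⟨a, b, two_mem_homogPart _ _⟩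
  · exact ⟨a, b, sub_mem (two_mem_homogPart _ _) (two_mem_homogPart _ _)⟩
  · exact ⟨lam, lam, sub_mem (two_mem_homogPart _ _)
      (sum_mem fun C _ => Submodule.smul_mem _ _ (two_mem_homogPart _ _))⟩

theorem pairingHom_two_dualPlucker {a c b : Weight m n} (f : a ⟶ c) (g : c ⟶ b)
    (a' b' : (Weight m n)ᵒᵖ) [Decidable (a' = op b ∧ b' = op a)] :
    pairingHom k (Weight m n) (two k f g) (∑ p : LengthTwo a' b', two k p.2.1 p.2.2) =
      if a' = op b ∧ b' = op a then 1 else 0 := by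
  classical
  rw [map_sum]
  split_ifs with h
  · obtain ⟨rfl, rfl⟩ := h
    rw [Finset.sum_eq_single ⟨op c, g.op, f.op⟩]
    · exact pairingHom_two_self f g
    · intro p _ hp
      refine pairingHom_two_of_ne _ _ _ _ fun _ h _ => hp (lengthTwo_ext h)
    · simp
  · exact Finset.sum_eq_zero fun p _ => pairingHom_two_of_ne _ _ _ _ fun h1 _ h2 => h ⟨h1, h2⟩

/-- The dual monomial relations are orthogonal to the relations: such a path is the only one between
its end points, and it is not a monomial relation. -/
theorem pairingHom_dualMonomialRel {d : PathAlgebra k (Weight m n)ᵒᵖ}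
    (hd : d ∈ dualMonomialRel k m n) {r : PathAlgebra k (Weight m n)}
    (hr : r ∈ monomialRel k m n ∪ commRel k m n ∪ vertexRel k m n) :
    pairingHom k (Weight m n) r d = 0 := by
  obtain ⟨a, c, b, f, g, hdm, rfl⟩ := mem_dualMonomialRel_iff.1 hd
  rcases hr with (hr | ⟨a', b', p, q, -, rfl⟩) | ⟨lam, κ, D, rfl⟩
  · obtain ⟨a', c', b', f', g', hm, rfl⟩ := mem_monomialRel_iff.1 hr
    refine pairingHom_two_of_ne _ _ _ _ fun h1 h2 h3 => ?_
    cases h1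
    cases h2
    cases h3
    exact hm.not_isDualMonomial hdm
  · by_cases hpq : p.1 = q.1
    · obtain ⟨x, f', g'⟩ := p
      obtain ⟨y, f'', g''⟩ := q
      obtain rfl : x = y := hpq
      rw [Subsingleton.elim f' f'', Subsingleton.elim g' g'', sub_self, map_zero,
        LinearMap.zero_apply]
    · rw [map_sub, LinearMap.sub_apply, pairingHom_two_of_ne, pairingHom_two_of_ne, sub_zero]
      · intro h1 h2 h3
        cases h1
        cases h3
        have h4 := hdm.middle_unique (adj_of_hom p.2.1) (adj_of_hom p.2.2)
        exact hpq (h4.trans (op_injective h2))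
      · intro h1 h2 h3
        cases h1
        cases h3
        have h4 := hdm.middle_unique (adj_of_hom q.2.1) (adj_of_hom q.2.2)
        exact hpq ((op_injective h2).symm.trans h4.symm)
  · have key : ∀ {x : Weight m n} (u : lam ⟶ x) (v : x ⟶ lam),
        pairingHom k (Weight m n) (two k u v) (two k g.op f.op) = 0 := by
      refine fun u v => pairingHom_two_of_ne _ _ _ _ fun h1 _ h3 => hdm.ne ?_
      exact (op_injective h3).trans (op_injective h1).symm
    simp only [map_sub, map_sum, map_smul, LinearMap.sub_apply, LinearMap.sum_apply,
      LinearMap.smul_apply, key, smul_zero, Finset.sum_const_zero, sub_zero]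

/-- The Plücker-type relations are orthogonal to the relations: there is only one path between the end
points of a monomial relation. -/
theorem pairingHom_dualPluckerRel {d : PathAlgebra k (Weight m n)ᵒᵖ}
    (hd : d ∈ dualPluckerRel k m n) {r : PathAlgebra k (Weight m n)}
    (hr : r ∈ monomialRel k m n ∪ commRel k m n ∪ vertexRel k m n) :
    pairingHom k (Weight m n) r d = 0 := by
  classical
  obtain ⟨a, b, hab, hcard, rfl⟩ := hd
  rcases hr with (hr | ⟨a', b', p, q, -, rfl⟩) | ⟨lam, κ, D, rfl⟩
  · obtain ⟨a', c', b', f', g', hm, rfl⟩ := mem_monomialRel_iff.1 hr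
    rw [pairingHom_two_dualPlucker, if_neg]
    rintro ⟨rfl, rfl⟩
    have hle : Fintype.card (LengthTwo (op b') (op a')) ≤ 1 := by
      refine Fintype.card_le_one_iff_subsingleton.2 ⟨fun p q => lengthTwo_ext ?_⟩
      have h1 := hm.middle_unique (adj_of_hom p.2.2.unop) (adj_of_hom p.2.1.unop)
      have h2 := hm.middle_unique (adj_of_hom q.2.2.unop) (adj_of_hom q.2.1.unop)
      exact unop_injective (h1.trans h2.symm)
    omega
  · rw [map_sub, LinearMap.sub_apply, pairingHom_two_dualPlucker, pairingHom_two_dualPlucker,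
      sub_self]
  · have key : ∀ {x : Weight m n} (u : lam ⟶ x) (v : x ⟶ lam),
        pairingHom k (Weight m n) (two k u v) (∑ p : LengthTwo a b, two k p.2.1 p.2.2) = 0 := by
      intro x u v
      rw [pairingHom_two_dualPlucker, if_neg]
      rintro ⟨rfl, rfl⟩
      exact hab rfl
    simp only [map_sub, map_smul, LinearMap.sub_apply, map_sum (pairingHom k (Weight m n)),
      LinearMap.sum_apply, LinearMap.smul_apply, key, smul_zero, Finset.sum_const_zero, sub_zero]

/-- The dual relations at vertices are orthogonal to the relations: the matrix of coefficients in the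
relations at a vertex is the negative transpose of the one in the dual relations. -/
theorem pairingHom_dualVertexRel {d : PathAlgebra k (Weight m n)ᵒᵖ}
    (hd : d ∈ dualVertexRel k m n) {r : PathAlgebra k (Weight m n)}
    (hr : r ∈ monomialRel k m n ∪ commRel k m n ∪ vertexRel k m n) :
    pairingHom k (Weight m n) r d = 0 := by
  classical
  obtain ⟨lam, μ, C, rfl⟩ := hd
  have key : ∀ {a b c : Weight m n} (f : a ⟶ c) (g : c ⟶ b), (a ≠ lam ∨ b ≠ lam) →
      pairingHom k (Weight m n) (two k f g) (two k C.ybar C.xbar +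
        ∑ D : (Σ κ : Weight m n, Raise κ lam),
          ((coeff D.2 C : ℤ) : k) • two k D.2.xbar D.2.ybar) = 0 := by
    intro a b c f g hab
    have key' : ∀ {x : (Weight m n)ᵒᵖ} (u : op lam ⟶ x) (v : x ⟶ op lam),
        pairingHom k (Weight m n) (two k f g) (two k u v) = 0 := by
      refine fun u v => pairingHom_two_of_ne _ _ _ _ fun h1 _ h3 => ?_
      rcases hab with h | h
      · exact h (op_injective h3).symm
      · exact h (op_injective h1).symm
    simp only [map_add, map_sum, map_smul, key', smul_zero, Finset.sum_const_zero, add_zero]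
  rcases hr with (hr | ⟨a', b', p, q, hab, rfl⟩) | ⟨lam', κ, D, rfl⟩
  · obtain ⟨a', c', b', f', g', hm, rfl⟩ := mem_monomialRel_iff.1 hr
    refine key f' g' ?_
    by_contra! hcon
    exact hm.ne (hcon.1.trans hcon.2.symm)
  · have hab' : a' ≠ lam ∨ b' ≠ lam := by
      by_contra! hcon
      exact hab (hcon.1.trans hcon.2.symm)
    rw [map_sub, LinearMap.sub_apply, key _ _ hab', key _ _ hab', sub_zero]
  · by_cases hlam : lam' = lam
    · subst hlam
      have hxy : ∀ (μ' : Weight m n) (C' : Raise lam' μ') (κ' : Weight m n) (D' : Raise κ' lam'),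
          pairingHom k (Weight m n) (two k C'.x C'.y) (two k D'.xbar D'.ybar) = 0 := by
        refine fun μ' C' κ' D' => pairingHom_two_of_ne _ _ _ _ fun _ h2 _ => ?_
        obtain rfl := op_injective h2
        exact C'.asymm D'
      have hyx : ∀ (κ' : Weight m n) (D' : Raise κ' lam'),
          pairingHom k (Weight m n) (two k D'.y D'.x) (two k C.ybar C.xbar) = 0 := by
        refine fun κ' D' => pairingHom_two_of_ne _ _ _ _ fun _ h2 _ => ?_
        obtain rfl := op_injective h2
        exact C.asymm D'
      have h1 : pairingHom k (Weight m n) (two k D.y D.x) (∑ D' : (Σ κ : Weight m n, Raise κ lam'),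
          ((coeff D'.2 C : ℤ) : k) • two k D'.2.xbar D'.2.ybar) = (coeff D C : ℤ) := by
        rw [map_sum, Finset.sum_eq_single ⟨κ, D⟩]
        · rw [map_smul]
          exact (congrArg _ (pairingHom_two_self D.y D.x)).trans (mul_one _)
        · rintro ⟨κ', D'⟩ _ hne
          rw [map_smul, pairingHom_two_of_ne, smul_zero]
          intro _ h2 _
          obtain rfl := op_injective h2
          exact hne (by rw [Subsingleton.elim D' D])
        · simp
      have h2 : ∑ C' : (Σ μ : Weight m n, Raise lam' μ), ((coeff D C'.2 : ℤ) : k) *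
          pairingHom k (Weight m n) (two k C'.2.x C'.2.y) (two k C.ybar C.xbar) =
            (coeff D C : ℤ) := by
        rw [Finset.sum_eq_single ⟨μ, C⟩]
        · exact (congrArg _ (pairingHom_two_self C.x C.y)).trans (mul_one _)
        · rintro ⟨μ', C'⟩ _ hne
          rw [pairingHom_two_of_ne, mul_zero]
          intro _ h2 _
          obtain rfl := op_injective h2
          exact hne (by rw [Subsingleton.elim C' C])
        · simp
      rw [map_sub, LinearMap.sub_apply, map_add, hyx, h1]
      simp only [map_sum, map_smul, map_add, LinearMap.sum_apply, LinearMap.smul_apply, hxy,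
        smul_eq_mul, mul_zero, Finset.sum_const_zero, add_zero, zero_add]
      rw [h2, sub_self]
    · simp only [map_sub, map_sum (pairingHom k (Weight m n)), map_smul (pairingHom k (Weight m n)),
        LinearMap.sub_apply, LinearMap.sum_apply, LinearMap.smul_apply]
      rw [key _ _ (Or.inl hlam)]
      simp only [key _ _ (Or.inl hlam), smul_zero, Finset.sum_const_zero, sub_zero]

theorem dualRel_mem_degreePart {d : PathAlgebra k (Weight m n)ᵒᵖ}
    (hd : d ∈ dualMonomialRel k m n ∪ dualPluckerRel k m n ∪ dualVertexRel k m n) :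
    d ∈ PathAlgebra.degreePart k (Weight m n)ᵒᵖ 2 := by
  rcases hd with (hd | ⟨a, b, -, -, rfl⟩) | ⟨lam, μ, C, rfl⟩
  · obtain ⟨a, c, b, f, g, -, rfl⟩ := mem_dualMonomialRel_iff.1 hd
    exact two_mem_degreePart _ _
  · exact sum_mem fun p _ => two_mem_degreePart _ _
  · exact add_mem (two_mem_degreePart _ _)
      (sum_mem fun D _ => Submodule.smul_mem _ _ (two_mem_degreePart _ _))

theorem dualRel_subset_quadraticPerp :
    dualMonomialRel k m n ∪ dualPluckerRel k m n ∪ dualVertexRel k m n ⊆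
      quadraticPerp (arcIdeal k m n) := by
  intro d hd
  refine mem_quadraticPerp_span (fun r hr => exists_mem_homogPart hr) (dualRel_mem_degreePart hd)
    fun r hr => ?_
  rcases hd with (hd | hd) | hd
  · exact pairingHom_dualMonomialRel hd hr
  · exact pairingHom_dualPluckerRel hd hr
  · exact pairingHom_dualVertexRel hd hr

/-! ### The orthogonal complement is spanned by the dual relations -/

theorem smul_mem_twoSidedIdeal {R A : Type*} [CommRing R] [Ring A] [Algebra R A]
    (I : TwoSidedIdeal A) (r : R) {x : A} (hx : x ∈ I) : r • x ∈ I := by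
  rw [Algebra.smul_def]
  exact I.mul_mem_left _ _ hx

/-- The cycles of length two at a vertex of the opposite quiver pass through the vertices above and
below it. -/
theorem sum_lengthTwo_self {M : Type*} [AddCommMonoid M] (lam : Weight m n)
    (F : LengthTwo (op lam) (op lam) → M) :
    ∑ p, F p = ∑ C : (Σ μ : Weight m n, Raise lam μ), F ⟨op C.1, C.2.ybar, C.2.xbar⟩ +
      ∑ D : (Σ κ : Weight m n, Raise κ lam), F ⟨op D.1, D.2.xbar, D.2.ybar⟩ := by
  let e : (Σ μ : Weight m n, Raise lam μ) ⊕ (Σ κ : Weight m n, Raise κ lam) →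
      LengthTwo (op lam) (op lam) :=
    Sum.elim (fun C => ⟨op C.1, C.2.ybar, C.2.xbar⟩) fun D => ⟨op D.1, D.2.xbar, D.2.ybar⟩
  have he : Function.Bijective e := by
    constructor
    · rintro (⟨μ, C⟩ | ⟨κ, D⟩) (⟨μ', C'⟩ | ⟨κ', D'⟩) h
      · obtain rfl : μ = μ' := op_injective (congrArg Sigma.fst h)
        rw [Subsingleton.elim C C']
      · obtain rfl : μ = κ' := op_injective (congrArg Sigma.fst h)
        exact (C.asymm D').elim
      · obtain rfl : κ = μ' := op_injective (congrArg Sigma.fst h)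
        exact (C'.asymm D).elim
      · obtain rfl : κ = κ' := op_injective (congrArg Sigma.fst h)
        rw [Subsingleton.elim D D']
    · rintro ⟨c, u, v⟩
      obtain ⟨D | C, -⟩ : ∃ x : c.unop ⟶ lam, x = u.unop := ⟨_, rfl⟩
      · exact ⟨Sum.inr ⟨c.unop, D⟩, lengthTwo_ext rfl⟩
      · exact ⟨Sum.inl ⟨c.unop, C⟩, lengthTwo_ext rfl⟩
  rw [← he.sum_comp F, Fintype.sum_sum_type]
  rfl

/-- The component of an orthogonal element between two distinct vertices lies in every ideal which
contains the dual relations: all its coefficients are equal, so it is a multiple of a Plücker-type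
relation if there are at least two paths, and a multiple of the only path otherwise; in the latter
case the path is a dual monomial relation or its coefficient vanishes. -/
theorem sum_mem_of_ne {I : TwoSidedIdeal (PathAlgebra k (Weight m n)ᵒᵖ)}
    (hI : dualMonomialRel k m n ∪ dualPluckerRel k m n ∪ dualVertexRel k m n ⊆ I)
    {g : PathAlgebra k (Weight m n)ᵒᵖ}
    (hg : ∀ r ∈ monomialRel k m n ∪ commRel k m n ∪ vertexRel k m n,
      pairingHom k (Weight m n) r g = 0) {a b : (Weight m n)ᵒᵖ} (hab : a ≠ b) :
    ∑ p : LengthTwo a b, pairingHom k (Weight m n) (two k p.2.2.unop p.2.1.unop) g •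
      two k p.2.1 p.2.2 ∈ I := by
  -- All coefficients are equal because of the commutativity relations.
  have hconst : ∀ p q : LengthTwo a b,
      pairingHom k (Weight m n) (two k p.2.2.unop p.2.1.unop) g =
        pairingHom k (Weight m n) (two k q.2.2.unop q.2.1.unop) g := by
    intro p q
    have := hg _ (Or.inl (Or.inr ⟨b.unop, a.unop, ⟨p.1.unop, p.2.2.unop, p.2.1.unop⟩,
      ⟨q.1.unop, q.2.2.unop, q.2.1.unop⟩, fun h => hab (unop_injective h).symm, rfl⟩))
    rwa [map_sub, LinearMap.sub_apply, sub_eq_zero] at this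
  rcases isEmpty_or_nonempty (LengthTwo a b) with hE | ⟨⟨p⟩⟩
  · rw [Fintype.sum_empty]
    exact I.zero_mem
  rw [Finset.sum_congr rfl fun q _ => by rw [hconst q p], ← Finset.smul_sum]
  by_cases hcard : 1 < Fintype.card (LengthTwo a b)
  · exact smul_mem_twoSidedIdeal I _ (hI (Or.inl (Or.inr ⟨a, b, hab, hcard, rfl⟩)))
  · have hsub : Subsingleton (LengthTwo a b) :=
      Fintype.card_le_one_iff_subsingleton.1 (by omega)
    rw [Finset.sum_eq_single p (fun q _ hq => absurd (Subsingleton.elim q p) hq) (by simp)]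
    obtain ⟨c, u, v⟩ := p
    rcases (adj_of_hom v.unop).classification (adj_of_hom u.unop)
      (fun h => hab (unop_injective h).symm) with h | h | ⟨c', hne, h1, h2⟩
    · rw [hg _ (Or.inl (Or.inl (mem_monomialRel_iff.2 ⟨_, _, _, v.unop, u.unop, h, rfl⟩))),
        zero_smul]
      exact I.zero_mem
    · exact smul_mem_twoSidedIdeal I _ (hI (Or.inl (Or.inl
        (mem_dualMonomialRel_iff.2 ⟨_, _, _, v.unop, u.unop, h, rfl⟩))))
    · obtain ⟨f⟩ := Weight.adj_iff.1 h1
      obtain ⟨f'⟩ := Weight.adj_iff.1 h2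
      have := congrArg Sigma.fst
        (Subsingleton.elim (⟨op c', f'.op, f.op⟩ : LengthTwo a b) ⟨c, u, v⟩)
      exact absurd (congrArg unop this) hne

/-- The component of an orthogonal element at a vertex is a combination of the dual relations at this
vertex. -/
theorem sum_mem_of_eq {I : TwoSidedIdeal (PathAlgebra k (Weight m n)ᵒᵖ)}
    (hI : dualMonomialRel k m n ∪ dualPluckerRel k m n ∪ dualVertexRel k m n ⊆ I)
    {g : PathAlgebra k (Weight m n)ᵒᵖ}
    (hg : ∀ r ∈ monomialRel k m n ∪ commRel k m n ∪ vertexRel k m n,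
      pairingHom k (Weight m n) r g = 0) (lam : Weight m n) :
    ∑ p : LengthTwo (op lam) (op lam),
      pairingHom k (Weight m n) (two k p.2.2.unop p.2.1.unop) g • two k p.2.1 p.2.2 ∈ I := by
  rw [sum_lengthTwo_self]
  -- The relations at `lam` express the coefficients of the cycles through lower vertices by the
  -- coefficients of the cycles through upper vertices.
  have hcoef : ∀ D : (Σ κ : Weight m n, Raise κ lam),
      pairingHom k (Weight m n) (two k D.2.y D.2.x) g =
        ∑ C : (Σ μ : Weight m n, Raise lam μ), ((coeff D.2 C.2 : ℤ) : k) *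
          pairingHom k (Weight m n) (two k C.2.x C.2.y) g := by
    intro D
    have := hg _ (Or.inr ⟨lam, D.1, D.2, rfl⟩)
    simpa only [map_sub, map_sum, map_smul, LinearMap.sub_apply, LinearMap.sum_apply,
      LinearMap.smul_apply, sub_eq_zero, smul_eq_mul] using this
  have hsum : (∑ C : (Σ μ : Weight m n, Raise lam μ),
        pairingHom k (Weight m n) (two k C.2.x C.2.y) g • two k C.2.ybar C.2.xbar +
      ∑ D : (Σ κ : Weight m n, Raise κ lam),
        pairingHom k (Weight m n) (two k D.2.y D.2.x) g • two k D.2.xbar D.2.ybar) =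
      ∑ C : (Σ μ : Weight m n, Raise lam μ), pairingHom k (Weight m n) (two k C.2.x C.2.y) g •
        (two k C.2.ybar C.2.xbar + ∑ D : (Σ κ : Weight m n, Raise κ lam),
          ((coeff D.2 C.2 : ℤ) : k) • two k D.2.xbar D.2.ybar) := by
    simp only [smul_add, Finset.sum_add_distrib, Finset.smul_sum]
    rw [Finset.sum_comm]
    congr 1
    refine Finset.sum_congr rfl fun D _ => ?_
    rw [hcoef, Finset.sum_smul]
    refine Finset.sum_congr rfl fun C _ => ?_
    rw [smul_smul, mul_comm]
  refine Eq.mpr (congrArg (· ∈ I) hsum) ?_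
  exact sum_mem fun C _ => smul_mem_twoSidedIdeal I _ (hI (Or.inr ⟨lam, C.1, C.2, rfl⟩))

theorem quadraticPerp_subset {I : TwoSidedIdeal (PathAlgebra k (Weight m n)ᵒᵖ)}
    (hI : dualMonomialRel k m n ∪ dualPluckerRel k m n ∪ dualVertexRel k m n ⊆ I) :
    quadraticPerp (arcIdeal k m n) ⊆ I := by
  rintro g ⟨hg2, hg⟩
  have hg' : ∀ r ∈ monomialRel k m n ∪ commRel k m n ∪ vertexRel k m n,
      pairingHom k (Weight m n) r g = 0 := by
    intro r hr
    obtain ⟨a, b, hab⟩ := exists_mem_homogPart hr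
    refine hg r (TwoSidedIdeal.subset_span hr) (Submodule.span_le.2 ?_ hab)
    rintro _ ⟨c, f, f', rfl⟩
    exact two_mem_degreePart f f'
  rw [eq_sum_pairingHom hg2]
  refine sum_mem fun a _ => sum_mem fun b _ => ?_
  by_cases hab : a = b
  · subst hab
    exact sum_mem_of_eq hI hg' a.unop
  · exact sum_mem_of_ne hI hg' hab

end ArcAlg

theorem proposition3p2 (k : Type*) [Field k] (m n : ℕ) (hm : 1 ≤ m) (hn : 1 ≤ n) :
    ArcAlg.dualIdeal k m n =
      TwoSidedIdeal.span
        (ArcAlg.dualMonomialRel k m n ∪ ArcAlg.dualPluckerRel k m n ∪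
          ArcAlg.dualVertexRel k m n) := by
  refine le_antisymm ?_ ?_
  · exact TwoSidedIdeal.span_le.2 (ArcAlg.quadraticPerp_subset TwoSidedIdeal.subset_span)
  · exact TwoSidedIdeal.span_mono ArcAlg.dualRel_subset_quadraticPerp
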